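/- For real $x>1$ and $\nu,\mu\in\mathbb C$ let $$P_\nu^\mu(x)=\Big(\frac{x+1}{x-1}\Big)^{\mu/2}\frac{1}{\Gamma(1-\mu)}\,{}_2F_1\Big(-\nu,\nu+1;1-\mu;\frac{1-x}{2}\Big),$$ and, for $\nu+\mu\notin\{-1,-2,\dots\}$, $$Q_\nu^\mu(x)=\frac{\sqrt\pi\,e^{i\pi\mu}\,\Gamma(\nu+\mu+1)\,(x^2-1)^{\mu/2}}{2^{\nu+1}\,x^{\nu+\mu+1}}\cdot\frac{1}{\Gamma(\nu+\frac32)}\,{}_2F_1\Big(\frac{\nu+\mu+1}{2},\frac{\nu+\mu+2}{2};\nu+\frac32;\frac1{x^2}\Big)$$ be the associated Legendre functions of the first and second kind. Here $\frac1{\Gamma(c)}\,{}_2F_1(a,b;c;z)$ denotes $\sum_{n\ge0}\frac{(a)_n(b)_n}{\Gamma(c+n)}\frac{z^n}{n!}$ for $|z|<1$ (with $1/\Gamma=0$ at the poles of $\Gamma$), and elsewhere on $\mathbb C\setminus[1,\infty)$ its analytic continuation; powers of positive numbers have their principal values. Let $$C_n^\mu(x)=\frac{(2\mu)_n}{n!}\,{}_2F_1\Big(-n,2\mu+n;\mu+\tfrac12;\frac{1-x}{2}\Big)$$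 be the Gegenbauer polynomials. **Theorem.** Let $\mu\in\mathbb C$ with $\operatorname{Re}\mu>-\frac12$ and $\mu\ne0$, let $\nu\in\mathbb C\setminus\{-1,-2,-3,\dots\}$, let $r,r'\in(0,\infty)$ with $r\neq r'$, and let $\gamma\in\mathbb R$. Put $r_<=\min\{r,r'\}$, $r_>=\max\{r,r'\}$, and let $\rho\ge0$ be given by $$\cosh\rho=\cosh r\cosh r'-\sinh r\sinh r'\cos\gamma .$$ Then $$\frac{P_\nu^\mu(\cosh\rho)}{\sinh^\mu\rho}=\frac{2^\mu\Gamma(\mu)}{(\sinh r\sinh r')^\mu}\sum_{n=0}^\infty(-1)^n(n+\mu)\,P_\nu^{-(\mu+n)}(\cosh r_<)\,P_\nu^{\mu+n}(\cosh r_>)\,C_n^\mu(\cos\gamma),$$ and, if in addition $\nu+\mu\notin\{-1,-2,-3,\dots\}$ (so that the functions $Q_\nu^{\mu+n}$, $n\ge0$, are defined), $$\frac{Q_\nu^\mu(\cosh\rho)}{\sinh^\mu\rho}=\frac{2^\mu\Gamma(\mu)}{(\sinh r\sinh r')^\mu}\sum_{n=0}^\infty(-1)^n(n+\mu)\,P_\nu^{-(\mu+n)}(\cosh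 r_<)\,Q_\nu^{\mu+n}(\cosh r_>)\,C_n^\mu(\cos\gamma),$$ both series being absolutely convergent. -/

import Mathlib

open scoped Topology

/-- The Gauss series of the regularized hypergeometric function `₂F₁(a, b; c; z) / Γ(c)`, that is
`∑ (a)ₙ (b)ₙ / Γ(c + n) * zⁿ / n!`. Mathlib's `Complex.Gamma` vanishes at the poles of the gamma
function, so that `(Γ(c + n))⁻¹` is the entire function `1 / Γ` evaluated at `c + n`. -/
noncomputable def regHypSeries (a b c z : ℂ) : ℂ :=
  ∑' n : ℕ, (ascPochhammer ℂ n).eval a * (ascPochhammer ℂ n).eval b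
    * (Complex.Gamma (c + n))⁻¹ * z ^ n / (n.factorial : ℂ)

/-- `w` is the value at `z` of the analytic continuation of the Gauss series from a neighbourhood
of `0`, to an open set containing `z` that is star-shaped about `0`. -/
def IsHypContinuation (a b c z w : ℂ) : Prop :=
  ∃ (U : Set ℂ) (f : ℂ → ℂ), IsOpen U ∧ StarConvex ℝ 0 U ∧ z ∈ U ∧ DifferentiableOn ℂ f U ∧
    (∀ᶠ s in 𝓝 (0 : ℂ), f s = regHypSeries a b c s) ∧ f z = w

/-- The value of the analytic continuation is unique. -/
theorem IsHypContinuation.unique {a b c z w₁ w₂ : ℂ} (h₁ : IsHypContinuation a b c z w₁)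
    (h₂ : IsHypContinuation a b c z w₂) : w₁ = w₂ := by
  obtain ⟨U, f, hU, sU, zU, dU, eU, rfl⟩ := h₁
  obtain ⟨V, g, hV, sV, zV, dV, eV, rfl⟩ := h₂
  have hs : StarConvex ℝ 0 (U ∩ V) := sU.inter sV
  have h0 : (0 : ℂ) ∈ U ∩ V := hs.mem ⟨z, zU, zV⟩
  have hc : IsPreconnected (U ∩ V) := (hs.isPathConnected h0).isConnected.isPreconnected
  have hf : AnalyticOnNhd ℂ f (U ∩ V) :=
    (dU.mono Set.inter_subset_left).analyticOnNhd (hU.inter hV)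
  have hg : AnalyticOnNhd ℂ g (U ∩ V) :=
    (dV.mono Set.inter_subset_right).analyticOnNhd (hU.inter hV)
  refine hf.eqOn_of_preconnected_of_eventuallyEq hg hc h0 ?_ ⟨zU, zV⟩
  filter_upwards [eU, eV] with s h₁ h₂
  rw [h₁, h₂]

open Classical in
/-- The regularized Gauss hypergeometric function `₂F₁(a, b; c; z) / Γ(c)`: the Gauss series for
`|z| < 1`, and elsewhere its analytic continuation. -/
noncomputable def regHyp (a b c z : ℂ) : ℂ :=
  if ‖z‖ < 1 then regHypSeries a b c z
  else if h : ∃ w, IsHypContinuation a b c z w then h.choose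
  else 0

/-- The associated Legendre function of the first kind `P_ν^μ(x)`, for real `x > 1`. -/
noncomputable def legendreP (ν μ : ℂ) (x : ℝ) : ℂ :=
  (((x + 1) / (x - 1) : ℝ) : ℂ) ^ (μ / 2) *
    regHyp (-ν) (ν + 1) (1 - μ) (((1 - x) / 2 : ℝ) : ℂ)

/-- The associated Legendre function of the second kind `Q_ν^μ(x)`, for real `x > 1` and
`ν + μ ∉ {-1, -2, …}`. -/
noncomputable def legendreQ (ν μ : ℂ) (x : ℝ) : ℂ :=
  (Real.sqrt Real.pi : ℂ) * Complex.exp (Complex.I * Real.pi * μ) * Complex.Gamma (ν + μ + 1) *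
      ((x ^ 2 - 1 : ℝ) : ℂ) ^ (μ / 2) / ((2 : ℂ) ^ (ν + 1) * (x : ℂ) ^ (ν + μ + 1)) *
    regHyp ((ν + μ + 1) / 2) ((ν + μ + 2) / 2) (ν + 3 / 2) ((1 / x ^ 2 : ℝ) : ℂ)

/-- The Gegenbauer polynomial `C_n^μ(x)` for `μ + 1/2 ∉ {0, -1, -2, …}`; the hypergeometric series
terminates. -/
noncomputable def gegenbauerC (n : ℕ) (μ x : ℂ) : ℂ :=
  (ascPochhammer ℂ n).eval (2 * μ) / (n.factorial : ℂ) *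
    ordinaryHypergeometric (-(n : ℂ)) (2 * μ + n) (μ + 1 / 2) ((1 - x) / 2)

/-! Let F_n(z) = (z² - 1)^{-(μ+n)/2} L^{μ+n}(z) with L = P_ν or Q_ν. Two facts about this family
suffice for both expansions: F_n' = F_{n+1}, and (z² - 1)F_{n+2} + 2(μ+n+1) z F_{n+1} +
((μ+n)(μ+n+1) - ν(ν+1)) F_n = 0. They are `hasDerivAt_reducedP`, `reducedP_recurrence` and their
analogues for `reducedQ`.

Take r < r', c = cosh r', s = sinh r', X = cosh r - 1, y = sinh r cos γ. Then cosh ρ = c + cX - sy,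
so F_0(cosh ρ) has a Taylor series in X and y whose coefficients involve only F_n(c). The
differential equation becomes a recurrence on these coefficients (`taylorCoeff_recurrence`). The
separated solutions K_n(X) R_n(y, Q), with Q = 2X + X² = sinh² r, R_n the homogenised Gegenbauer
polynomial and K_n the radial hypergeometric series, obey the same recurrence
(`expansionCoeff_recurrence`). The recurrence determines everything from the row X = 0, where R_n
reduces to its leading power of y; matching that row fixes the coefficients
(`expansionCoeff_eq_taylorCoeff`). Crude geometric bounds turn the formal identity into one valid
for small r (`exists_addition_germ`).

The identity is then continued analytically in u = tanh(r/2) up to v = tanh(r'/2). On the left, cosh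
ρ > 1 for real |u| < v (`one_lt_coshRho`). On the right, Pfaff's transformation makes the radial
functions hypergeometric in u² and bounded uniformly in n; Cauchy's estimate gives F_n(c)/n! of size
about (c - 1)^{-n}, and s v = c - 1, so the terms decay like (|u|/v)^n up to subexponential factors
(`exists_summable_norm_additionTerm_le`). The same bound gives absolute convergence. -/

/-! ### Rising factorials and the regularized Gauss series -/

/-- The rising factorial `(a)ₙ`. -/
noncomputable abbrev poch (a : ℂ) (n : ℕ) : ℂ := (ascPochhammer ℂ n).eval a

theorem poch_zero (a : ℂ) : poch a 0 = 1 := by simp [poch]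

theorem poch_succ (a : ℂ) (n : ℕ) : poch a (n + 1) = poch a n * (a + n) :=
  ascPochhammer_succ_eval n a

theorem poch_succ_left (a : ℂ) (n : ℕ) : poch a (n + 1) = a * poch (a + 1) n := by
  simp [poch, ascPochhammer_succ_left, Polynomial.eval_comp]

theorem mul_poch_add_one (a : ℂ) (n : ℕ) : a * poch (a + 1) n = poch a n * (a + n) := by
  rw [← poch_succ, poch_succ_left]

theorem poch_add (a : ℂ) (m n : ℕ) : poch a (m + n) = poch a m * poch (a + m) n := by
  induction n with
  | zero => simp [poch_zero]
  | succ n ih =>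
    rw [← add_assoc, poch_succ, poch_succ, ih]
    push_cast
    ring

theorem inv_Gamma_eq_mul (s : ℂ) : (Complex.Gamma s)⁻¹ = s * (Complex.Gamma (s + 1))⁻¹ :=
  Complex.one_div_Gamma_eq_self_mul_one_div_Gamma_add_one s

theorem poch_mul_inv_Gamma (s : ℂ) (n : ℕ) :
    poch s n * (Complex.Gamma (s + n))⁻¹ = (Complex.Gamma s)⁻¹ := by
  induction n with
  | zero => simp [poch_zero]
  | succ n ih =>
    rw [← ih, poch_succ, inv_Gamma_eq_mul (s + n)]
    push_cast
    ring_nf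

/-- The coefficients of the regularized Gauss series. -/
noncomputable def hypCoeff (a b c : ℂ) (n : ℕ) : ℂ :=
  poch a n * poch b n * (Complex.Gamma (c + n))⁻¹ / (n.factorial : ℂ)

theorem regHypSeries_eq_tsum (a b c z : ℂ) :
    regHypSeries a b c z = ∑' n : ℕ, hypCoeff a b c n * z ^ n := by
  refine tsum_congr fun n => ?_
  rw [hypCoeff]
  ring

theorem hypCoeff_zero (a b c : ℂ) : hypCoeff a b c 0 = (Complex.Gamma c)⁻¹ := by
  simp [hypCoeff, poch_zero]

theorem hypCoeff_symm (a b c : ℂ) (n : ℕ) : hypCoeff a b c n = hypCoeff b a c n := by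
  rw [hypCoeff, hypCoeff]
  ring

/-- The ratio of consecutive terms, multiplied out: 1/Γ(s) = s/Γ(s+1) also holds at the poles, so c
may be a nonpositive integer. -/
theorem hypCoeff_succ (a b c : ℂ) (n : ℕ) :
    (c + n) * (n + 1) * hypCoeff a b c (n + 1) = (a + n) * (b + n) * hypCoeff a b c n := by
  have h : ((n + 1).factorial : ℂ) = (n + 1) * (n.factorial : ℂ) := by
    rw [Nat.factorial_succ]; push_cast; ring
  have h1 : (n.factorial : ℂ) ≠ 0 := by exact_mod_cast n.factorial_ne_zero
  have h2 : (n + 1 : ℂ) ≠ 0 := by exact_mod_cast n.succ_ne_zero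
  rw [hypCoeff, hypCoeff, inv_Gamma_eq_mul (c + n), poch_succ, poch_succ, h]
  push_cast
  rw [← add_assoc]
  field_simp

theorem summable_norm_hypCoeff (a b c z : ℂ) (hz : ‖z‖ < 1) :
    Summable fun n : ℕ => ‖hypCoeff a b c n * z ^ n‖ := by
  obtain ⟨r, hzr, hr1⟩ := exists_between hz
  have hlim : Filter.Tendsto
      (fun n : ℕ => ‖(a + 1 * n) / (c + 1 * n) * ((b + 1 * n) / (1 + 1 * n)) * z‖)
      Filter.atTop (𝓝 ‖(1 / 1 : ℂ) * (1 / 1) * z‖) :=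
    (((tendsto_add_mul_div_add_mul_atTop_nhds a c 1 one_ne_zero).mul
      (tendsto_add_mul_div_add_mul_atTop_nhds b 1 1 one_ne_zero)).mul_const z).norm
  have hev := hlim.eventually_lt_const (u := r) (by simpa using hzr)
  -- The quotient form of the ratio is available only where c + n ≠ 0; n > ‖c‖ is enough.
  have hc : ∀ᶠ n : ℕ in Filter.atTop, c + n ≠ 0 := by
    obtain ⟨N, hN⟩ := exists_nat_gt ‖c‖
    filter_upwards [Filter.eventually_ge_atTop N] with n hn h0
    have h1 : c = -(n : ℂ) := eq_neg_of_add_eq_zero_left h0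
    have h2 : (n : ℝ) < N + 0 := by
      have := hN
      rw [h1, norm_neg, Complex.norm_natCast] at this
      simpa using this
    have h3 : (N : ℝ) ≤ n := by exact_mod_cast hn
    linarith
  refine summable_of_ratio_norm_eventually_le (r := r) hr1 ?_
  filter_upwards [hev, hc] with n hn hcn
  have h2 : (n + 1 : ℂ) ≠ 0 := by exact_mod_cast n.succ_ne_zero
  have key : hypCoeff a b c (n + 1) * z ^ (n + 1) =
      ((a + 1 * n) / (c + 1 * n) * ((b + 1 * n) / (1 + 1 * n)) * z) *
        (hypCoeff a b c n * z ^ n) := by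
    have h3 : hypCoeff a b c (n + 1) =
        (a + n) * (b + n) * hypCoeff a b c n / ((c + n) * (n + 1)) := by
      rw [eq_div_iff (mul_ne_zero hcn h2), ← hypCoeff_succ]
      ring
    rw [h3, add_comm (1 : ℂ) (1 * (n : ℂ)), one_mul, pow_succ]
    field_simp
  rw [key, norm_norm, norm_norm, norm_mul]
  exact mul_le_mul_of_nonneg_right hn.le (norm_nonneg _)

theorem summable_hypCoeff (a b c z : ℂ) (hz : ‖z‖ < 1) :
    Summable fun n : ℕ => hypCoeff a b c n * z ^ n :=
  (summable_norm_hypCoeff a b c z hz).of_norm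

theorem hasSum_regHypSeries (a b c z : ℂ) (hz : ‖z‖ < 1) :
    HasSum (fun n : ℕ => hypCoeff a b c n * z ^ n) (regHypSeries a b c z) := by
  rw [regHypSeries_eq_tsum]
  exact (summable_hypCoeff a b c z hz).hasSum

/-- Terms of a convergent series are bounded. Several growth estimates below come from recognising a
quantity as such a coefficient with special parameters. -/
theorem exists_norm_hypCoeff_le (a b c : ℂ) {r : ℝ} (h0 : 0 < r) (h1 : r < 1) :
    ∃ C : ℝ, 0 ≤ C ∧ ∀ n, ‖hypCoeff a b c n‖ * r ^ n ≤ C := by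
  have hs := summable_norm_hypCoeff a b c (r : ℂ) (by simpa [abs_of_pos h0] using h1)
  refine ⟨∑' n, ‖hypCoeff a b c n * (r : ℂ) ^ n‖, tsum_nonneg fun _ => norm_nonneg _, fun n => ?_⟩
  have := hs.le_tsum n fun _ _ => norm_nonneg _
  simpa [abs_of_pos h0] using this

theorem differentiableOn_tsum_mul_pow {q : ℕ → ℂ}
    (hq : ∀ z : ℂ, ‖z‖ < 1 → Summable fun n : ℕ => ‖q n * z ^ n‖) :
    DifferentiableOn ℂ (fun z => ∑' n, q n * z ^ n) (Metric.ball 0 1) := by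
  intro z hz
  rw [mem_ball_zero_iff] at hz
  obtain ⟨r, hzr, hr1⟩ := exists_between hz
  have hr0 : 0 ≤ r := (norm_nonneg z).trans hzr.le
  have hd : DifferentiableOn ℂ (fun z => ∑' n, q n * z ^ n) (Metric.ball 0 r) := by
    refine Complex.differentiableOn_tsum_of_summable_norm
      (hq (r : ℂ) (by simpa [abs_of_nonneg hr0] using hr1)) (fun n => by fun_prop)
      Metric.isOpen_ball fun n w hw => ?_
    rw [mem_ball_zero_iff] at hw
    simp only [norm_mul, norm_pow, Complex.norm_real, Real.norm_eq_abs, abs_of_nonneg hr0]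
    gcongr
  exact (hd.differentiableAt (Metric.isOpen_ball.mem_nhds (by simpa using hzr))).differentiableWithinAt

theorem hasSum_mul_deriv_tsum_mul_pow {q : ℕ → ℂ}
    (hq : ∀ z : ℂ, ‖z‖ < 1 → Summable fun n : ℕ => ‖q n * z ^ n‖) {z : ℂ} (hz : ‖z‖ < 1) :
    HasSum (fun n : ℕ => n * q n * z ^ n) (z * deriv (fun z => ∑' n, q n * z ^ n) z) := by
  obtain ⟨r, hzr, hr1⟩ := exists_between hz
  have hr0 : 0 ≤ r := (norm_nonneg z).trans hzr.le
  have hs := Complex.hasSum_deriv_of_summable_norm (F := fun n z => q n * z ^ n)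
    (U := Metric.ball 0 r) (z := z)
    (hq (r : ℂ) (by simpa [abs_of_nonneg hr0] using hr1)) (fun n => by fun_prop)
    Metric.isOpen_ball (fun n w hw => by
      rw [mem_ball_zero_iff] at hw
      simp only [norm_mul, norm_pow, Complex.norm_real, Real.norm_eq_abs, abs_of_nonneg hr0]
      gcongr) (by simpa using hzr)
  refine (hs.mul_left z).congr_fun fun n => ?_
  rcases n with _ | n
  · simp
  · simp
    ring

theorem differentiableOn_regHypSeries (a b c : ℂ) :
    DifferentiableOn ℂ (regHypSeries a b c) (Metric.ball 0 1) := by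
  rw [funext (regHypSeries_eq_tsum a b c)]
  exact differentiableOn_tsum_mul_pow (summable_norm_hypCoeff a b c)

theorem hasSum_mul_deriv_regHypSeries (a b c : ℂ) {z : ℂ} (hz : ‖z‖ < 1) :
    HasSum (fun n : ℕ => n * hypCoeff a b c n * z ^ n) (z * deriv (regHypSeries a b c) z) := by
  rw [funext (regHypSeries_eq_tsum a b c)]
  exact hasSum_mul_deriv_tsum_mul_pow (summable_norm_hypCoeff a b c) hz

/-! ### Pfaff's transformation and continuation to a half-plane -/

/-- The Chu–Vandermonde identity, in regularized form. -/
theorem sum_neg_one_pow_mul_choose_mul_poch (c d : ℂ) (N : ℕ) :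
    ∑ k ∈ Finset.range (N + 1),
      (-1 : ℂ) ^ k * (N.choose k) * poch d k * (Complex.Gamma (c + k))⁻¹ =
      poch (c - d) N * (Complex.Gamma (c + N))⁻¹ := by
  induction N generalizing c d with
  | zero => simp [poch_zero]
  | succ N ih =>
    -- Pascal's rule splits the sum; in the second part the shift of k raises both c and d by one,
    -- which is why the induction generalizes over them.
    have h1 : ∑ k ∈ Finset.range (N + 1 + 1),
        (-1 : ℂ) ^ k * ((N + 1).choose k) * poch d k * (Complex.Gamma (c + k))⁻¹ =
        ∑ k ∈ Finset.range (N + 1),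
          (-1 : ℂ) ^ k * (N.choose k) * poch d k * (Complex.Gamma (c + k))⁻¹ -
        d * ∑ k ∈ Finset.range (N + 1),
          (-1 : ℂ) ^ k * (N.choose k) * poch (d + 1) k * (Complex.Gamma (c + 1 + k))⁻¹ := by
      have h2 : ∑ k ∈ Finset.range (N + 1),
          (-1 : ℂ) ^ k * (N.choose k) * poch d k * (Complex.Gamma (c + k))⁻¹ =
          ∑ k ∈ Finset.range (N + 1 + 1),
          (-1 : ℂ) ^ k * (N.choose k) * poch d k * (Complex.Gamma (c + k))⁻¹ := by
        rw [Finset.sum_range_succ _ (N + 1)]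
        simp
      rw [h2, Finset.sum_range_succ', Finset.sum_range_succ' _ (N + 1), Finset.mul_sum,
        add_sub_right_comm, ← Finset.sum_sub_distrib]
      congr 1
      · refine Finset.sum_congr rfl fun k _ => ?_
        rw [Nat.choose_succ_succ, poch_succ_left]
        push_cast
        rw [add_assoc c 1 (k : ℂ), add_comm (1 : ℂ) (k : ℂ)]
        ring
      · simp
    rw [h1, ih, ih, inv_Gamma_eq_mul (c + N), poch_succ]
    have h3 : c + 1 - (d + 1) = c - d := by ring
    have h4 : c + 1 + (N : ℂ) = c + N + 1 := by ring
    rw [h3, h4]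
    push_cast
    rw [← add_assoc]
    ring

theorem hasSum_poch_div_factorial (s : ℂ) {w : ℂ} (hw : ‖w‖ < 1) :
    HasSum (fun m : ℕ => poch s m / m.factorial * w ^ m) ((1 - w) ^ (-s)) := by
  have h := (Complex.one_div_one_sub_cpow_hasFPowerSeriesOnBall_zero s).hasSum (y := w)
    (by simpa [enorm_eq_nnnorm, ← NNReal.coe_lt_coe] using hw)
  simp only [zero_add, one_div, ← Complex.cpow_neg] at h
  refine h.congr_fun fun m => ?_
  have h1 : (m.factorial : ℂ) * Ring.choose (s + m - 1) m = poch s m := by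
    have := Ring.descPochhammer_eq_factorial_smul_choose (s + m - 1 : ℂ) m
    rw [Polynomial.descPochhammer_smeval_eq_ascPochhammer,
      Polynomial.ascPochhammer_smeval_cast, Polynomial.ascPochhammer_smeval_eq_eval,
      show s + m - 1 - m + 1 = s by ring] at this
    rw [poch, this, nsmul_eq_mul]
  have h2 : (m.factorial : ℂ) ≠ 0 := by exact_mod_cast m.factorial_ne_zero
  rw [← h1, mul_div_cancel_left₀ _ h2]
  simp [FormalMultilinearSeries.ofScalars]

theorem hypCoeff_one_one (a : ℂ) (n : ℕ) : hypCoeff a 1 1 n = poch a n / n.factorial := by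
  have h2 : (n.factorial : ℂ) ≠ 0 := by exact_mod_cast n.factorial_ne_zero
  rw [hypCoeff, add_comm (1 : ℂ), Complex.Gamma_nat_eq_factorial]
  simp [poch, ascPochhammer_eval_one]
  field_simp

theorem hypCoeff_one (a c : ℂ) (n : ℕ) :
    hypCoeff a 1 c n = poch a n * (Complex.Gamma (c + n))⁻¹ := by
  have h2 : (n.factorial : ℂ) ≠ 0 := by exact_mod_cast n.factorial_ne_zero
  rw [hypCoeff]
  simp [poch, ascPochhammer_eval_one]
  field_simp

/-- The general term is a binomial-series coefficient times a `hypCoeff` times a binomial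
coefficient. Bounding these by multiples of 2^(k+m), 2^k and 2^(k+m) gives the ratios 8‖w‖ and 4‖w‖,
hence the radius 1/8. -/
theorem summable_pfaff (a c d : ℂ) {w : ℂ} (hw : ‖w‖ < 1 / 8) :
    Summable fun p : ℕ × ℕ => poch a (p.1 + p.2) * (-1) ^ p.1 * poch d p.1 *
      (Complex.Gamma (c + p.1))⁻¹ / (p.1.factorial * p.2.factorial) * w ^ (p.1 + p.2) := by
  obtain ⟨C, hC0, hC⟩ := exists_norm_hypCoeff_le a 1 1 (r := 1 / 2) (by norm_num) (by norm_num)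
  obtain ⟨D, hD0, hD⟩ := exists_norm_hypCoeff_le d 1 c (r := 1 / 2) (by norm_num) (by norm_num)
  have hs : Summable fun p : ℕ × ℕ => (C * D) * ((8 * ‖w‖) ^ p.1 * (4 * ‖w‖) ^ p.2) :=
    ((summable_geometric_of_lt_one (by positivity) (by linarith)).mul_of_nonneg
      (summable_geometric_of_lt_one (by positivity) (by linarith))
      (fun _ => by positivity) (fun _ => by positivity)).mul_left _
  refine Summable.of_norm_bounded hs fun ⟨k, m⟩ => ?_
  have e : poch a (k + m) * (-1) ^ k * poch d k *
      (Complex.Gamma (c + k))⁻¹ / (k.factorial * m.factorial) * w ^ (k + m) =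
      hypCoeff a 1 1 (k + m) * hypCoeff d 1 c k * ((k + m).choose k : ℂ) * (-1) ^ k *
        w ^ (k + m) := by
    have h2 : (k.factorial : ℂ) ≠ 0 := by exact_mod_cast k.factorial_ne_zero
    have h3 : (m.factorial : ℂ) ≠ 0 := by exact_mod_cast m.factorial_ne_zero
    have h4 : ((k + m).factorial : ℂ) ≠ 0 := by exact_mod_cast (k + m).factorial_ne_zero
    have h5 : ((k + m).choose k : ℂ) * k.factorial * m.factorial = (k + m).factorial := by
      have := Nat.add_choose_mul_factorial_mul_factorial k m
      rw [← Nat.choose_symm_add] at this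
      exact_mod_cast this
    rw [hypCoeff_one_one, hypCoeff_one, ← h5]
    have h6 : ((k + m).choose k : ℂ) ≠ 0 := by
      intro h0
      rw [h0] at h5
      simp at h5
      exact h4 h5.symm
    field_simp
  have hCk : ‖hypCoeff a 1 1 (k + m)‖ ≤ C * 2 ^ (k + m) := by
    have := hC (k + m)
    rw [one_div, inv_pow, ← div_eq_mul_inv, div_le_iff₀ (by positivity)] at this
    exact this
  have hDk : ‖hypCoeff d 1 c k‖ ≤ D * 2 ^ k := by
    have := hD k
    rw [one_div, inv_pow, ← div_eq_mul_inv, div_le_iff₀ (by positivity)] at this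
    exact this
  have hch : (((k + m).choose k : ℕ) : ℝ) ≤ 2 ^ (k + m) := by
    exact_mod_cast Nat.choose_le_two_pow (k + m) k
  rw [e]
  simp only [norm_mul, norm_pow, norm_neg, norm_one, one_pow, mul_one, Complex.norm_natCast]
  calc ‖hypCoeff a 1 1 (k + m)‖ * ‖hypCoeff d 1 c k‖ * ((k + m).choose k : ℝ) * ‖w‖ ^ (k + m)
      ≤ (C * 2 ^ (k + m)) * (D * 2 ^ k) * 2 ^ (k + m) * ‖w‖ ^ (k + m) := by gcongr
    _ = C * D * ((8 * ‖w‖) ^ k * (4 * ‖w‖) ^ m) := by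
      rw [show (8 : ℝ) = 2 * 2 * 2 by norm_num, show (4 : ℝ) = 2 * 2 by norm_num]
      simp only [mul_pow, pow_add]
      ring

theorem tsum_eq_tsum_sum_antidiagonal {g : ℕ × ℕ → ℂ} (hg : Summable g) :
    ∑' p, g p = ∑' N, ∑ p ∈ Finset.HasAntidiagonal.antidiagonal N, g p := by
  rw [← Finset.HasAntidiagonal.sigmaAntidiagonalEquivProd.tsum_eq g]
  refine ((Finset.HasAntidiagonal.sigmaAntidiagonalEquivProd.summable_iff.mpr hg).tsum_sigma'
      (fun n => (hasSum_fintype _).summable)).trans ?_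
  refine tsum_congr fun N => ?_
  rw [tsum_fintype, Finset.univ_eq_attach]
  exact Finset.sum_attach (Finset.HasAntidiagonal.antidiagonal N) g

/-- Pfaff's transformation near `0`. -/
theorem regHypSeries_eq_pfaff_of_small (a b c : ℂ) {w : ℂ} (hw : ‖w‖ < 1 / 8) :
    regHypSeries a b c w =
      (1 - w) ^ (-a) * regHypSeries a (c - b) c (w / (w - 1)) := by
  have hs := summable_pfaff a c (c - b) hw
  have hw1 : ‖w‖ < 1 := hw.trans (by norm_num)
  have hne : 1 - w ≠ 0 := by
    intro h
    rw [← sub_eq_zero.mp h] at hw1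
    simp at hw1
  have hne' : w - 1 ≠ 0 := by
    intro h
    exact hne (by linear_combination -h)
  have e1 := hs.tsum_prod
  have e2 := tsum_eq_tsum_sum_antidiagonal hs
  rw [regHypSeries_eq_tsum, regHypSeries_eq_tsum, ← tsum_mul_left]
  -- One double series summed in two ways: along k + m = N the inner sum is Chu–Vandermonde; over m
  -- first it is the binomial series of (1 - w)^(-a-k).
  trans ∑' p : ℕ × ℕ, poch a (p.1 + p.2) * (-1) ^ p.1 * poch (c - b) p.1 *
      (Complex.Gamma (c + p.1))⁻¹ / (p.1.factorial * p.2.factorial) * w ^ (p.1 + p.2)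
  · rw [e2]
    refine tsum_congr fun N => ?_
    rw [Finset.Nat.sum_antidiagonal_eq_sum_range_succ_mk]
    have h4 : (N.factorial : ℂ) ≠ 0 := by exact_mod_cast N.factorial_ne_zero
    have hv := sum_neg_one_pow_mul_choose_mul_poch c (c - b) N
    rw [sub_sub_cancel] at hv
    have : hypCoeff a b c N * w ^ N =
        poch a N / N.factorial * w ^ N * (poch b N * (Complex.Gamma (c + N))⁻¹) := by
      rw [hypCoeff]
      ring
    rw [this, ← hv, Finset.mul_sum]
    refine Finset.sum_congr rfl fun k hk => ?_
    have hkN : k ≤ N := Nat.lt_succ_iff.mp (Finset.mem_range.mp hk)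
    have h5 : (N.choose k : ℂ) * k.factorial * (N - k).factorial = N.factorial := by
      exact_mod_cast Nat.choose_mul_factorial_mul_factorial hkN
    have h2 : (k.factorial : ℂ) ≠ 0 := by exact_mod_cast k.factorial_ne_zero
    have h3 : ((N - k).factorial : ℂ) ≠ 0 := by exact_mod_cast (N - k).factorial_ne_zero
    simp only [Nat.add_sub_cancel' hkN]
    rw [← h5] at h4 ⊢
    have h6 : (N.choose k : ℂ) ≠ 0 := by
      intro h0
      simp [h0] at h4
    field_simp
  · rw [e1]
    refine tsum_congr fun k => ?_
    have hb := (hasSum_poch_div_factorial (a + k) hw1).mul_left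
      (poch a k * (-1) ^ k * poch (c - b) k * (Complex.Gamma (c + k))⁻¹ / k.factorial * w ^ k)
    have : (fun m : ℕ => poch a (k + m) * (-1) ^ k * poch (c - b) k *
        (Complex.Gamma (c + k))⁻¹ / (k.factorial * m.factorial) * w ^ (k + m)) =
        fun m : ℕ => poch a k * (-1) ^ k * poch (c - b) k * (Complex.Gamma (c + k))⁻¹ /
          k.factorial * w ^ k * (poch (a + k) m / m.factorial * w ^ m) := by
      funext m
      rw [poch_add, pow_add]
      ring
    rw [this, hb.tsum_eq, hypCoeff, neg_add, Complex.cpow_add _ _ hne, Complex.cpow_neg _ (k : ℂ),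
      Complex.cpow_natCast, ← neg_sub 1 w, div_neg, neg_pow (w / (1 - w)), div_pow]
    ring

/-- The half-plane consists of the points closer to 0 than to 1. -/
theorem norm_div_sub_one_lt_one {w : ℂ} (hw : w.re < 1 / 2) : ‖w / (w - 1)‖ < 1 := by
  have hne : w - 1 ≠ 0 := by
    intro h
    rw [sub_eq_zero.mp h] at hw
    norm_num at hw
  rw [norm_div, div_lt_one (norm_pos_iff.mpr hne)]
  rw [← sq_lt_sq₀ (norm_nonneg _) (norm_nonneg _), Complex.sq_norm, Complex.sq_norm,
    Complex.normSq_apply, Complex.normSq_apply]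
  simp
  nlinarith

/-- The continuation of the regularized Gauss series to the half-plane `Re w < 1/2` given by Pfaff's
transformation. -/
noncomputable def pfaffHyp (a b c w : ℂ) : ℂ :=
  (1 - w) ^ (-a) * regHypSeries a (c - b) c (w / (w - 1))

theorem isOpen_re_lt_half : IsOpen {w : ℂ | w.re < 1 / 2} :=
  isOpen_lt Complex.continuous_re continuous_const

theorem convex_re_lt_half : Convex ℝ {w : ℂ | w.re < 1 / 2} :=
  convex_halfSpace_re_lt _

theorem differentiableOn_pfaffHyp (a b c : ℂ) :
    DifferentiableOn ℂ (pfaffHyp a b c) {w : ℂ | w.re < 1 / 2} := by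
  intro w hw
  change w.re < 1 / 2 at hw
  have hne : w - 1 ≠ 0 := by
    intro h
    rw [sub_eq_zero.mp h] at hw
    norm_num at hw
  have h1 : DifferentiableAt ℂ (fun w : ℂ => (1 - w) ^ (-a)) w := by
    refine DifferentiableAt.cpow (by fun_prop) (by fun_prop) (Or.inl ?_)
    simp
    linarith
  have h2 : DifferentiableAt ℂ (fun w : ℂ => regHypSeries a (c - b) c (w / (w - 1))) w := by
    have h3 := (differentiableOn_regHypSeries a (c - b) c).differentiableAt
      (Metric.isOpen_ball.mem_nhds (mem_ball_zero_iff.mpr (norm_div_sub_one_lt_one hw)))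
    exact h3.comp (f := fun w : ℂ => w / (w - 1)) w (by fun_prop (disch := assumption))
  exact (h1.mul h2).differentiableWithinAt

theorem regHypSeries_eventuallyEq_pfaffHyp (a b c : ℂ) :
    regHypSeries a b c =ᶠ[𝓝 0] pfaffHyp a b c := by
  filter_upwards [Metric.ball_mem_nhds (0 : ℂ) (show (0 : ℝ) < 1 / 8 by norm_num)] with w hw
  exact regHypSeries_eq_pfaff_of_small a b c (mem_ball_zero_iff.mp hw)

theorem regHypSeries_eq_pfaffHyp (a b c : ℂ) {w : ℂ} (hw : ‖w‖ < 1) (hw' : w.re < 1 / 2) :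
    regHypSeries a b c w = pfaffHyp a b c w := by
  have hU : IsOpen (Metric.ball (0 : ℂ) 1 ∩ {w : ℂ | w.re < 1 / 2}) :=
    Metric.isOpen_ball.inter isOpen_re_lt_half
  have h1 := ((differentiableOn_regHypSeries a b c).mono
    (Set.inter_subset_left (t := {w : ℂ | w.re < 1 / 2}))).analyticOnNhd hU
  have h2 := ((differentiableOn_pfaffHyp a b c).mono
    (Set.inter_subset_right (s := Metric.ball (0 : ℂ) 1))).analyticOnNhd hU
  exact h1.eqOn_of_preconnected_of_eventuallyEq h2
    ((convex_ball _ _).inter convex_re_lt_half).isPreconnected (z₀ := 0) (by simp)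
    (regHypSeries_eventuallyEq_pfaffHyp a b c) ⟨mem_ball_zero_iff.mpr hw, hw'⟩

/-- The half-plane is star-shaped about 0, so uniqueness of the continuation applies. It contains (1
- x)/2 for every x > 1, also where the Gauss series diverges. -/
theorem regHyp_eq_pfaffHyp (a b c : ℂ) {w : ℂ} (hw : w.re < 1 / 2) :
    regHyp a b c w = pfaffHyp a b c w := by
  rw [regHyp]
  split_ifs with h1 h2
  · exact regHypSeries_eq_pfaffHyp a b c h1 hw
  all_goals
    have h : IsHypContinuation a b c w (pfaffHyp a b c w) :=
      ⟨{w : ℂ | w.re < 1 / 2}, pfaffHyp a b c, isOpen_re_lt_half,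
        convex_re_lt_half.starConvex (by simp), hw, differentiableOn_pfaffHyp a b c,
        (regHypSeries_eventuallyEq_pfaffHyp a b c).symm, rfl⟩
  · exact h2.choose_spec.unique h
  · exact absurd ⟨_, h⟩ h2

/-! ### Gegenbauer polynomials: the three-term recurrence -/

/-- The factor n + 2 is invertible, so two initial values determine the sequence. The parameter s is
1 for the polynomials themselves and σ² for their homogenised form. -/
theorem eq_of_gegenbauer_recurrence {μ t : ℂ} {f g : ℕ → ℂ} (h0 : f 0 = g 0) (h1 : f 1 = g 1)
    {s : ℂ}
    (hf : ∀ n : ℕ, (n + 2) * f (n + 2) = 2 * (n + 1 + μ) * t * f (n + 1) - (n + 2 * μ) * s * f n)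
    (hg : ∀ n : ℕ, (n + 2) * g (n + 2) = 2 * (n + 1 + μ) * t * g (n + 1) - (n + 2 * μ) * s * g n)
    (n : ℕ) : f n = g n := by
  induction n using Nat.strong_induction_on with
  | _ n ih =>
    match n with
    | 0 => exact h0
    | 1 => exact h1
    | n + 2 =>
      have h2 : (n + 2 : ℂ) ≠ 0 := by exact_mod_cast (n + 1).succ_ne_zero
      refine mul_left_cancel₀ h2 ?_
      rw [hf, hg, ih n (by omega), ih (n + 1) (by omega)]

/-- The coefficient of `((1 - x) / 2) ^ k` in `C_n^μ(x)`. -/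
noncomputable def gegenbauerCoeff (μ : ℂ) (n k : ℕ) : ℂ :=
  (-1) ^ k * (n.choose k) * poch (2 * μ) (n + k) / (n.factorial * poch (μ + 1 / 2) k)

/-- The cut-off N is free so that polynomials of three consecutive degrees can be summed over one
range. -/
theorem gegenbauerC_eq_sum (μ x : ℂ) (n N : ℕ) (hN : n < N) :
    gegenbauerC n μ x = ∑ k ∈ Finset.range N, gegenbauerCoeff μ n k * ((1 - x) / 2) ^ k := by
  have h : ∀ k : ℕ, (ascPochhammer ℂ k).eval (-(n : ℂ)) =
      (-1) ^ k * (k.factorial * n.choose k) := by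
    intro k
    rw [ascPochhammer_eval_neg_eq_descPochhammer, descPochhammer_eval_eq_descFactorial,
      Nat.descFactorial_eq_factorial_mul_choose]
    push_cast
    ring
  rw [gegenbauerC, ordinaryHypergeometric_eq_tsum]
  beta_reduce
  rw [tsum_eq_sum (s := Finset.range N),
    Finset.mul_sum]
  · refine Finset.sum_congr rfl fun k _ => ?_
    have h2 : (k.factorial : ℂ) ≠ 0 := by exact_mod_cast k.factorial_ne_zero
    rw [h, gegenbauerCoeff, poch_add, smul_eq_mul]
    simp only [poch]
    field_simp
  · intro k hk
    rw [h, Nat.choose_eq_zero_of_lt (by simp at hk; omega)]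
    simp

theorem poch_half_ne_zero {μ : ℂ} (hμ : -(1 / 2 : ℝ) < μ.re) (k : ℕ) : μ + 1 / 2 + k ≠ 0 := by
  intro h
  have := congrArg Complex.re h
  simp at this
  have hk : (0 : ℝ) ≤ k := k.cast_nonneg
  norm_num at hμ
  linarith

theorem poch_ne_zero {a : ℂ} (h : ∀ k : ℕ, a + k ≠ 0) (n : ℕ) : poch a n ≠ 0 := by
  induction n with
  | zero => simp [poch_zero]
  | succ n ih => rw [poch_succ]; exact mul_ne_zero ih (h n)

theorem gegenbauerCoeff_recurrence_zero (μ : ℂ) (n : ℕ) :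
    (n + 2) * gegenbauerCoeff μ (n + 2) 0 - 2 * (n + 1 + μ) * gegenbauerCoeff μ (n + 1) 0 +
      (n + 2 * μ) * gegenbauerCoeff μ n 0 = 0 := by
  have h1 : (n.factorial : ℂ) ≠ 0 := by exact_mod_cast n.factorial_ne_zero
  have h2 : (n + 2 : ℂ) ≠ 0 := by exact_mod_cast (n + 1).succ_ne_zero
  have h3 : (n + 1 : ℂ) ≠ 0 := by exact_mod_cast n.succ_ne_zero
  simp only [gegenbauerCoeff, Nat.choose_zero_right, pow_zero, poch_zero, add_zero, poch_succ,
    Nat.factorial_succ, Nat.cast_mul, Nat.cast_add, Nat.cast_one]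
  rw [show (n + 1 + 1 : ℂ) = n + 2 by ring]
  field_simp
  ring

/-- With x = 1 - 2·(1-x)/2 the factor x in the three-term recurrence contributes one extra power of
(1-x)/2; this is the term of index k on the right. -/
theorem gegenbauerCoeff_recurrence_succ {μ : ℂ} (hμ : -(1 / 2 : ℝ) < μ.re) (n k : ℕ)
    (hk : k ≤ n + 1) :
    (n + 2) * gegenbauerCoeff μ (n + 2) (k + 1) -
      2 * (n + 1 + μ) * gegenbauerCoeff μ (n + 1) (k + 1) +
      (n + 2 * μ) * gegenbauerCoeff μ n (k + 1) =
      -4 * (n + 1 + μ) * gegenbauerCoeff μ (n + 1) k := by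
  have h1 : (n.factorial : ℂ) ≠ 0 := by exact_mod_cast n.factorial_ne_zero
  have h2 : (n + 2 : ℂ) ≠ 0 := by exact_mod_cast (n + 1).succ_ne_zero
  have h3 : (n + 1 : ℂ) ≠ 0 := by exact_mod_cast n.succ_ne_zero
  have hk1 : (k + 1 : ℂ) ≠ 0 := by exact_mod_cast k.succ_ne_zero
  have hq : poch (μ + 1 / 2) k ≠ 0 := poch_ne_zero (poch_half_ne_zero hμ) k
  have hq' : 2 * μ + 1 + 2 * k ≠ 0 := by
    intro h
    exact poch_half_ne_zero hμ k (by linear_combination h / 2)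
  have c1 : ((n + 2).choose (k + 1) : ℂ) = (n + 2) * (n + 1).choose k / (k + 1) := by
    rw [eq_div_iff hk1]
    have := Nat.add_one_mul_choose_eq (n + 1) k
    have : ((n + 1 + 1) * (n + 1).choose k : ℂ) = (n + 1 + 1).choose (k + 1) * (k + 1) := by
      exact_mod_cast this
    linear_combination -this
  have c2 : ((n + 1).choose (k + 1) : ℂ) = (n + 1 - k) * (n + 1).choose k / (k + 1) := by
    rw [eq_div_iff hk1]
    have := Nat.choose_succ_right_eq (n + 1) k
    have : ((n + 1).choose (k + 1) * (k + 1) : ℂ) = (n + 1).choose k * ((n + 1 - k : ℕ) : ℂ) := by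
      exact_mod_cast this
    rw [this, Nat.cast_sub hk]
    push_cast
    ring
  -- The difference n - k is taken in ℂ and may be negative: for n < k the binomial on the right
  -- vanishes, for n = k the factor does.
  have c3 : (n.choose (k + 1) : ℂ) = (n - k) * (n + 1).choose (k + 1) / (n + 1) := by
    rw [eq_div_iff h3]
    rcases Nat.lt_or_ge n (k + 1) with h | h
    · rw [Nat.choose_eq_zero_of_lt h]
      rcases Nat.lt_or_ge n k with h' | h'
      · rw [Nat.choose_eq_zero_of_lt (show n + 1 < k + 1 by omega)]
        simp
      · rw [show n = k by omega]
        simp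
    · have := Nat.choose_mul_succ_eq n (k + 1)
      have : (n.choose (k + 1) * (n + 1) : ℂ) =
          (n + 1).choose (k + 1) * ((n + 1 - (k + 1) : ℕ) : ℂ) := by
        exact_mod_cast this
      rw [this, Nat.cast_sub (by omega)]
      push_cast
      ring
  have p1 : poch (2 * μ) (n + 1 + k) = poch (2 * μ) (n + (k + 1)) := by congr 1; ring
  have p2 : poch (2 * μ) (n + 1 + (k + 1)) =
      poch (2 * μ) (n + (k + 1)) * (2 * μ + n + k + 1) := by
    rw [show n + 1 + (k + 1) = n + (k + 1) + 1 by ring, poch_succ]; push_cast; ring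
  have p3 : poch (2 * μ) (n + 2 + (k + 1)) =
      poch (2 * μ) (n + (k + 1)) * (2 * μ + n + k + 1) * (2 * μ + n + k + 2) := by
    rw [show n + 2 + (k + 1) = n + 1 + (k + 1) + 1 by ring, poch_succ, p2]; push_cast; ring
  have f1 : ((n + 1).factorial : ℂ) = (n + 1) * n.factorial := by
    rw [Nat.factorial_succ]; push_cast; ring
  have f2 : ((n + 2).factorial : ℂ) = (n + 2) * ((n + 1) * n.factorial) := by
    rw [Nat.factorial_succ, Nat.cast_mul, f1]; push_cast; ring
  simp only [gegenbauerCoeff]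
  rw [c1, c3, c2, p1, p2, p3, f1, f2, poch_succ (μ + 1 / 2), pow_succ,
    show μ + 1 / 2 + (k : ℂ) = (2 * μ + 1 + 2 * k) / 2 by ring]
  set p := poch (2 * μ) (n + (k + 1))
  set q := poch (μ + 1 / 2) k
  set C := ((n + 1).choose k : ℂ)
  field_simp
  ring

theorem gegenbauerC_recurrence {μ : ℂ} (hμ : -(1 / 2 : ℝ) < μ.re) (x : ℂ) (n : ℕ) :
    (n + 2) * gegenbauerC (n + 2) μ x =
      2 * (n + 1 + μ) * x * gegenbauerC (n + 1) μ x - (n + 2 * μ) * 1 * gegenbauerC n μ x := by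
  have hx : x = 1 - 2 * ((1 - x) / 2) := by ring
  rw [gegenbauerC_eq_sum μ x (n + 2) (n + 2 + 1) (by omega),
    gegenbauerC_eq_sum μ x n (n + 2 + 1) (by omega)]
  have e1 := gegenbauerC_eq_sum μ x (n + 1) (n + 2) (by omega)
  have e2 := gegenbauerC_eq_sum μ x (n + 1) (n + 2 + 1) (by omega)
  have key : (n + 2) * ∑ k ∈ Finset.range (n + 2 + 1),
        gegenbauerCoeff μ (n + 2) k * ((1 - x) / 2) ^ k -
      2 * (n + 1 + μ) * ∑ k ∈ Finset.range (n + 2 + 1),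
        gegenbauerCoeff μ (n + 1) k * ((1 - x) / 2) ^ k +
      (n + 2 * μ) * ∑ k ∈ Finset.range (n + 2 + 1),
        gegenbauerCoeff μ n k * ((1 - x) / 2) ^ k =
      -4 * (n + 1 + μ) * ((1 - x) / 2) * ∑ k ∈ Finset.range (n + 2),
        gegenbauerCoeff μ (n + 1) k * ((1 - x) / 2) ^ k := by
    rw [Finset.mul_sum, Finset.mul_sum, Finset.mul_sum, ← Finset.sum_sub_distrib,
      ← Finset.sum_add_distrib, Finset.sum_range_succ', Finset.mul_sum]
    have h0 := gegenbauerCoeff_recurrence_zero μ n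
    rw [← add_zero (∑ k ∈ Finset.range (n + 2), -4 * (n + 1 + μ) * ((1 - x) / 2) * _)]
    congr 1
    · refine Finset.sum_congr rfl fun k hk => ?_
      have := gegenbauerCoeff_recurrence_succ hμ n k
        (by have := Finset.mem_range.mp hk; omega)
      linear_combination ((1 - x) / 2) ^ (k + 1) * this
    · linear_combination h0
  rw [← e1, ← e2] at key
  linear_combination key

theorem gegenbauerC_zero (μ x : ℂ) : gegenbauerC 0 μ x = 1 := by
  rw [gegenbauerC_eq_sum μ x 0 1 (by omega)]
  simp [gegenbauerCoeff, poch_zero]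

theorem gegenbauerC_one {μ : ℂ} (hμ : -(1 / 2 : ℝ) < μ.re) (x : ℂ) :
    gegenbauerC 1 μ x = 2 * μ * x := by
  have h : 2 * μ + 1 ≠ 0 := by
    intro h
    exact poch_half_ne_zero hμ 0 (by push_cast; linear_combination h / 2)
  rw [gegenbauerC_eq_sum μ x 1 2 (by omega), Finset.sum_range_succ, Finset.sum_range_one]
  simp only [gegenbauerCoeff, poch_succ, poch_zero]
  norm_num [poch_zero, poch_succ]
  rw [show μ + 1 / 2 = (2 * μ + 1) / 2 by ring]
  field_simp
  ring

/-! ### The homogenised Gegenbauer polynomials -/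

/-- The coefficient of `y ^ (n - 2 * l) * Q ^ l` in the homogeneous polynomial
`σ ^ n * C_n^μ(y / σ)`, `Q = σ ^ 2`, as a function of `j = n - 2 * l` and `l`. -/
noncomputable def gegenbauerHom (μ : ℂ) (j l : ℕ) : ℂ :=
  (-1) ^ l * poch μ (j + l) * 2 ^ j / (l.factorial * j.factorial)

/-- The terms of the homogeneous polynomial `σ ^ n * C_n^μ(y / σ)`, `Q = σ ^ 2`. -/
noncomputable def gegenbauerTerm (μ y Q : ℂ) (n l : ℕ) : ℂ :=
  if 2 * l ≤ n then gegenbauerHom μ (n - 2 * l) l * y ^ (n - 2 * l) * Q ^ l else 0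

theorem gegenbauerHom_zero_succ (μ : ℂ) (l : ℕ) :
    (2 * l + 2) * gegenbauerHom μ 0 (l + 1) = -((2 * l + 2 * μ) * gegenbauerHom μ 0 l) := by
  have h1 : (l.factorial : ℂ) ≠ 0 := by exact_mod_cast l.factorial_ne_zero
  have h2 : (l + 1 : ℂ) ≠ 0 := by exact_mod_cast l.succ_ne_zero
  simp only [gegenbauerHom, Nat.factorial_succ, zero_add, poch_succ, pow_succ]
  push_cast
  field_simp
  ring

theorem gegenbauerHom_succ_zero (μ : ℂ) (j : ℕ) :
    (j + 1) * gegenbauerHom μ (j + 1) 0 = 2 * (j + μ) * gegenbauerHom μ j 0 := by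
  have h1 : (j.factorial : ℂ) ≠ 0 := by exact_mod_cast j.factorial_ne_zero
  have h2 : (j + 1 : ℂ) ≠ 0 := by exact_mod_cast j.succ_ne_zero
  simp only [gegenbauerHom, Nat.factorial_succ, add_zero, poch_succ, pow_succ]
  push_cast
  field_simp
  ring

theorem gegenbauerHom_succ_succ (μ : ℂ) (j l : ℕ) :
    (j + 2 * l + 3) * gegenbauerHom μ (j + 1) (l + 1) =
      2 * (j + 2 * l + 2 + μ) * gegenbauerHom μ j (l + 1) -
        (j + 2 * l + 1 + 2 * μ) * gegenbauerHom μ (j + 1) l := by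
  have h1 : (j.factorial : ℂ) ≠ 0 := by exact_mod_cast j.factorial_ne_zero
  have h2 : (j + 1 : ℂ) ≠ 0 := by exact_mod_cast j.succ_ne_zero
  have h3 : (l.factorial : ℂ) ≠ 0 := by exact_mod_cast l.factorial_ne_zero
  have h4 : (l + 1 : ℂ) ≠ 0 := by exact_mod_cast l.succ_ne_zero
  have p1 : poch μ (j + (l + 1)) = poch μ (j + l) * (μ + j + l) := by
    rw [← add_assoc, poch_succ]; push_cast; ring
  have p2 : poch μ (j + 1 + l) = poch μ (j + l) * (μ + j + l) := by
    rw [← p1]; congr 1; ring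
  have p3 : poch μ (j + 1 + (l + 1)) = poch μ (j + l) * (μ + j + l) * (μ + j + l + 1) := by
    rw [← add_assoc, poch_succ, p2]; push_cast; ring
  simp only [gegenbauerHom, Nat.factorial_succ, p1, p2, p3, pow_succ]
  push_cast
  field_simp
  ring

theorem gegenbauerTerm_zero_recurrence (μ y Q : ℂ) (n : ℕ) :
    (n + 2) * gegenbauerTerm μ y Q (n + 2) 0 =
      2 * (n + 1 + μ) * y * gegenbauerTerm μ y Q (n + 1) 0 := by
  have := gegenbauerHom_succ_zero μ (n + 1)
  push_cast at this
  simp only [gegenbauerTerm, mul_zero, Nat.zero_le, if_true, Nat.sub_zero, pow_zero, mul_one]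
  rw [pow_succ]
  linear_combination y ^ (n + 1) * y * this

theorem gegenbauerTerm_succ_recurrence (μ y Q : ℂ) (n l : ℕ) :
    (n + 2) * gegenbauerTerm μ y Q (n + 2) (l + 1) =
      2 * (n + 1 + μ) * y * gegenbauerTerm μ y Q (n + 1) (l + 1) -
        (n + 2 * μ) * Q * gegenbauerTerm μ y Q n l := by
  rcases lt_trichotomy n (2 * l) with h | h | h
  · simp only [gegenbauerTerm]
    rw [if_neg (by omega), if_neg (by omega), if_neg (by omega)]
    ring
  · subst h
    have := gegenbauerHom_zero_succ μ l
    simp only [gegenbauerTerm]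
    rw [if_pos (by omega), if_neg (by omega), if_pos (by omega),
      show 2 * l + 2 - 2 * (l + 1) = 0 by omega, Nat.sub_self]
    push_cast
    linear_combination Q ^ (l + 1) * this
  · obtain ⟨j, rfl⟩ : ∃ j, n = 2 * l + 1 + j := ⟨n - (2 * l + 1), by omega⟩
    have := gegenbauerHom_succ_succ μ j l
    simp only [gegenbauerTerm]
    rw [if_pos (by omega), if_pos (by omega), if_pos (by omega),
      show 2 * l + 1 + j + 2 - 2 * (l + 1) = j + 1 by omega,
      show 2 * l + 1 + j + 1 - 2 * (l + 1) = j by omega,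
      show 2 * l + 1 + j - 2 * l = j + 1 by omega]
    push_cast
    linear_combination y ^ (j + 1) * Q ^ (l + 1) * this

theorem sum_gegenbauerTerm_extend (μ y Q : ℂ) (n N : ℕ) (hN : n < N) :
    ∑ l ∈ Finset.range N, gegenbauerTerm μ y Q n l =
      ∑ l ∈ Finset.range (n + 1), gegenbauerTerm μ y Q n l := by
  refine (Finset.sum_subset (Finset.range_mono hN) fun l _ hl => ?_).symm
  rw [gegenbauerTerm, if_neg]
  simp at hl
  omega

/-- Both sides satisfy the recurrence homogenised by σ. The left side is polynomial in y = σt and Q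
= σ², so no square root of 2X + X² enters the power series in X and y. -/
theorem sum_gegenbauerTerm {μ : ℂ} (hμ : -(1 / 2 : ℝ) < μ.re) (t σ : ℂ) (n : ℕ) :
    ∑ l ∈ Finset.range (n + 1), gegenbauerTerm μ (σ * t) (σ ^ 2) n l =
      σ ^ n * gegenbauerC n μ t := by
  refine eq_of_gegenbauer_recurrence (μ := μ) (t := σ * t) (s := σ ^ 2)
    (f := fun n => ∑ l ∈ Finset.range (n + 1), gegenbauerTerm μ (σ * t) (σ ^ 2) n l)
    (g := fun n => σ ^ n * gegenbauerC n μ t) ?_ ?_ ?_ ?_ n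
  · simp [gegenbauerTerm, gegenbauerHom, gegenbauerC_zero, poch_zero]
  · simp [Finset.sum_range_succ, gegenbauerTerm, gegenbauerHom, gegenbauerC_one hμ, poch_zero,
      poch_succ]
    ring
  · intro n
    rw [← sum_gegenbauerTerm_extend μ (σ * t) (σ ^ 2) (n + 1) (n + 2 + 1) (by omega),
      ← sum_gegenbauerTerm_extend μ (σ * t) (σ ^ 2) n (n + 2) (by omega),
      Finset.sum_range_succ', Finset.sum_range_succ' _ (n + 2), mul_add, mul_add,
      gegenbauerTerm_zero_recurrence, Finset.mul_sum, Finset.mul_sum, Finset.mul_sum,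
      add_sub_right_comm, ← Finset.sum_sub_distrib]
    congr 1
    exact Finset.sum_congr rfl fun l _ => gegenbauerTerm_succ_recurrence μ _ _ n l
  · intro n
    have := gegenbauerC_recurrence hμ t n
    simp only [pow_succ]
    linear_combination σ ^ n * σ * σ * this

/-! ### The generating function and the growth of Gegenbauer polynomials -/

open PowerSeries in
/-- The binomial series `(1 - αX)^{-μ}`. -/
noncomputable def binomSeries (μ α : ℂ) : PowerSeries ℂ :=
  PowerSeries.mk fun k => poch μ k / k.factorial * α ^ k

open PowerSeries in
theorem binomSeries_deriv (μ α : ℂ) :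
    (1 - C α * X) * derivative ℂ (binomSeries μ α) = C (μ * α) * binomSeries μ α := by
  ext n
  have h1 : (n.factorial : ℂ) ≠ 0 := by exact_mod_cast n.factorial_ne_zero
  have h2 : (n + 1 : ℂ) ≠ 0 := by exact_mod_cast n.succ_ne_zero
  rcases n with _ | n
  · simp only [sub_mul, mul_assoc, one_mul, map_sub, coeff_C_mul, coeff_zero_X_mul, binomSeries,
      coeff_derivative, coeff_mk]
    simp [poch_zero, poch_succ]
  · have h3 : (n + 1 + 1 : ℂ) ≠ 0 := by exact_mod_cast (n + 1).succ_ne_zero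
    have h4 : (n + 1 : ℂ) ≠ 0 := by exact_mod_cast n.succ_ne_zero
    have h5 : (n.factorial : ℂ) ≠ 0 := by exact_mod_cast n.factorial_ne_zero
    simp only [sub_mul, mul_assoc, one_mul, map_sub, coeff_C_mul, coeff_succ_X_mul, binomSeries,
      coeff_derivative, coeff_mk, poch_succ, Nat.factorial_succ, pow_succ]
    push_cast
    field_simp
    ring

open PowerSeries in
theorem gegenbauerC_eq_coeff {μ : ℂ} (hμ : -(1 / 2 : ℝ) < μ.re) {α β t : ℂ} (h1 : α * β = 1)
    (h2 : α + β = 2 * t) (n : ℕ) :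
    gegenbauerC n μ t = coeff n (binomSeries μ α * binomSeries μ β) := by
  set G := binomSeries μ α * binomSeries μ β with hG
  -- The logarithmic derivative of (1 - 2tX + X²)^(-μ), cleared of denominators; its coefficients
  -- are the three-term recurrence.
  have hd : (1 - C (2 * t) * X + X * X) * derivative ℂ G = C (2 * μ) * ((C t - X) * G) := by
    have ha := binomSeries_deriv μ α
    have hb := binomSeries_deriv μ β
    have e1 : (C (2 * t) : PowerSeries ℂ) = C α + C β := by rw [← h2, map_add]
    have e2 : (C α * C β : PowerSeries ℂ) = 1 := by rw [← map_mul, h1, map_one]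
    have e3 : (C (2 * t) : PowerSeries ℂ) = 2 * C t := by rw [map_mul]; rfl
    have e4 : (C (2 * μ) : PowerSeries ℂ) = 2 * C μ := by rw [map_mul]; rfl
    rw [map_mul] at ha hb
    rw [hG, Derivation.leibniz, smul_eq_mul, smul_eq_mul, e4]
    linear_combination (1 - C β * X) * binomSeries μ β * ha +
      (1 - C α * X) * binomSeries μ α * hb +
      (-X * (binomSeries μ α * derivative ℂ (binomSeries μ β) +
        binomSeries μ β * derivative ℂ (binomSeries μ α))) * e1 -
      X * X * (binomSeries μ α * derivative ℂ (binomSeries μ β) +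
        binomSeries μ β * derivative ℂ (binomSeries μ α)) * e2 -
      2 * C μ * X * binomSeries μ α * binomSeries μ β * e2
      + C μ * binomSeries μ α * binomSeries μ β * (e3 - e1)
  refine eq_of_gegenbauer_recurrence (μ := μ) (t := t) (s := 1) (f := fun n => gegenbauerC n μ t)
    (g := fun n => coeff n G) ?_ ?_ (gegenbauerC_recurrence hμ t) ?_ n
  · simp [hG, gegenbauerC_zero, coeff_mul, binomSeries, poch_zero]
  · simp [hG, gegenbauerC_one hμ, coeff_mul, binomSeries, poch_zero, poch_succ,
      Finset.Nat.antidiagonal_succ]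
    linear_combination -μ * h2
  · intro n
    have := congrArg (coeff (n + 1)) hd
    rcases n with _ | n
    · simp [add_mul, sub_mul, mul_assoc, coeff_derivative, coeff_succ_X_mul] at this ⊢
      linear_combination this
    · simp only [add_mul, sub_mul, mul_assoc, one_mul, map_sub, map_add, coeff_C_mul,
        coeff_succ_X_mul, coeff_derivative] at this
      push_cast at this ⊢
      linear_combination this

theorem exists_norm_le_of_summable_norm {f : ℕ → ℂ} (h : Summable fun n => ‖f n‖) :
    ∃ C : ℝ, 0 ≤ C ∧ ∀ n, ‖f n‖ ≤ C :=
  ⟨∑' n, ‖f n‖, tsum_nonneg fun _ => norm_nonneg _,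
    fun n => h.le_tsum n fun _ _ => norm_nonneg _⟩

/-- The generating function factors as (1 - e^{iγ}X)^{-μ}(1 - e^{-iγ}X)^{-μ}. Both factors converge
absolutely for |X| = q < 1, hence so does their Cauchy product. -/
theorem exists_norm_gegenbauerC_le {μ : ℂ} (hμ : -(1 / 2 : ℝ) < μ.re) (γ : ℝ) {q : ℝ}
    (h0 : 0 < q) (h1 : q < 1) :
    ∃ C : ℝ, 0 ≤ C ∧ ∀ n, ‖gegenbauerC n μ (Real.cos γ)‖ * q ^ n ≤ C := by
  set α := Complex.exp (γ * Complex.I) with hα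
  set β := Complex.exp (-γ * Complex.I) with hβ
  have hαβ : α * β = 1 := by
    rw [hα, hβ, ← Complex.exp_add]
    simp
  have hsum : α + β = 2 * (Real.cos γ : ℂ) := by
    rw [Complex.ofReal_cos, Complex.cos]
    ring
  have nα : ‖α‖ = 1 := Complex.norm_exp_ofReal_mul_I γ
  have nβ : ‖β‖ = 1 := by
    have := Complex.norm_exp_ofReal_mul_I (-γ)
    rwa [Complex.ofReal_neg] at this
  have hs : ∀ a : ℂ, ‖a‖ = 1 →
      Summable fun k : ℕ => ‖poch μ k / k.factorial * a ^ k * (q : ℂ) ^ k‖ := by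
    intro a ha
    have := summable_norm_hypCoeff μ 1 1 (a * q) (by
      rw [norm_mul, ha, one_mul, Complex.norm_real, Real.norm_eq_abs, abs_of_pos h0]
      exact h1)
    refine this.congr fun k => ?_
    rw [hypCoeff_one_one, mul_pow, mul_assoc]
  have hp := summable_norm_sum_mul_antidiagonal_of_summable_norm (hs α nα) (hs β nβ)
  obtain ⟨C, hC0, hC⟩ := exists_norm_le_of_summable_norm hp
  refine ⟨C, hC0, fun n => (le_of_eq ?_).trans (hC n)⟩
  rw [gegenbauerC_eq_coeff hμ hαβ hsum, PowerSeries.coeff_mul]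
  have : q ^ n = ‖(q : ℂ) ^ n‖ := by simp [abs_of_pos h0]
  rw [this, ← norm_mul, Finset.sum_mul]
  congr 1
  refine Finset.sum_congr rfl fun p hp => ?_
  rw [← Finset.HasAntidiagonal.mem_antidiagonal.mp hp, pow_add]
  simp only [binomSeries, PowerSeries.coeff_mk]
  ring

/-! ### The formal identity in X = x - 1 and y -/

section Germ

/-- The constant `(μ + m)(μ + m + 1) - ν(ν + 1)` of the differential equation of order `μ + m`. -/
noncomputable def legendreConst (μ ν : ℂ) (m : ℕ) : ℂ :=
  (μ + m) * (μ + m + 1) - ν * (ν + 1)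

/-- The coefficient of `X ^ i * y ^ j` in the expansion of `F (c + c * X - s * y)`, where
`φ m` is the `m`-th derivative of `F` at `c`. -/
noncomputable def taylorCoeff (c s : ℂ) (φ : ℕ → ℂ) (i j : ℕ) : ℂ :=
  φ (i + j) * c ^ i * (-s) ^ j / (i.factorial * j.factorial)

/-- The relation between φ(m), φ(m+1), φ(m+2) at m = i + j, multiplied by c^i (-s)^j / (i! j!): the
extra c belongs to one more X, the extra s² to two more y. -/
theorem taylorCoeff_recurrence {μ ν c s : ℂ} {φ : ℕ → ℂ}
    (hφ : ∀ m : ℕ, s ^ 2 * φ (m + 2) + 2 * (μ + m + 1) * c * φ (m + 1) +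
      legendreConst μ ν m * φ m = 0) (i j : ℕ) :
    2 * (i + 1) * (i + j + 1 + μ) * taylorCoeff c s φ (i + 1) j +
      (j + 2) * (j + 1) * taylorCoeff c s φ i (j + 2) +
      legendreConst μ ν (i + j) * taylorCoeff c s φ i j = 0 := by
  have h1 : (j.factorial : ℂ) ≠ 0 := by exact_mod_cast j.factorial_ne_zero
  have h2 : (j + 1 : ℂ) ≠ 0 := by exact_mod_cast j.succ_ne_zero
  have h3 : (i.factorial : ℂ) ≠ 0 := by exact_mod_cast i.factorial_ne_zero
  have h4 : (i + 1 : ℂ) ≠ 0 := by exact_mod_cast i.succ_ne_zero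
  have h5 : (j + 2 : ℂ) ≠ 0 := by exact_mod_cast (j + 1).succ_ne_zero
  have f1 : ((i + 1).factorial : ℂ) = (i + 1) * i.factorial := by
    rw [Nat.factorial_succ]; push_cast; ring
  have f2 : ((j + 2).factorial : ℂ) = (j + 2) * ((j + 1) * j.factorial) := by
    rw [Nat.factorial_succ, Nat.factorial_succ]; push_cast; ring
  have h := hφ (i + j)
  simp only [taylorCoeff]
  rw [show i + 1 + j = i + j + 1 by ring, show i + (j + 2) = i + j + 2 by ring, f1, f2]
  simp only [pow_succ]
  push_cast at h
  field_simp
  linear_combination c ^ i * (-s) ^ j * h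

open PowerSeries

/-- The power series in `X = x - 1` of the regularized hypergeometric function
`₂F₁(1 + μ + n + ν, μ + n - ν; 1 + μ + n; (1 - x) / 2) / Γ(1 + μ + n)`. -/
noncomputable def radialSeries (μ ν : ℂ) (n : ℕ) : PowerSeries ℂ :=
  PowerSeries.mk fun i => hypCoeff (1 + μ + n + ν) (μ + n - ν) (1 + μ + n) i * (-1 / 2) ^ i

/-- The degree-preserving part of the operator has X^i as eigenvector. Its eigenvalue i(i-1) +
2(j+μ+1)i, added to the constant of order j, is the constant of order i + j. -/
theorem coeff_legendreOp (μ ν : ℂ) (j : ℕ) (f : PowerSeries ℂ) (i : ℕ) :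
    coeff i ((2 * X + X ^ 2) * derivative ℂ (derivative ℂ f) +
      C (2 * (j + μ + 1)) * ((1 + X) * derivative ℂ f) + C (legendreConst μ ν j) * f) =
      2 * (i + 1) * (i + j + 1 + μ) * coeff (i + 1) f +
        legendreConst μ ν (i + j) * coeff i f := by
  have h2 : (2 : PowerSeries ℂ) = C 2 := rfl
  rw [h2, sq]
  rcases i with _ | _ | i
  · simp only [add_mul, mul_assoc, one_mul, map_add, coeff_C_mul, coeff_zero_X_mul,
      coeff_derivative, legendreConst]
    push_cast
    ring_nf
  · simp only [add_mul, mul_assoc, one_mul, map_add, coeff_C_mul, coeff_succ_X_mul,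
      coeff_zero_X_mul, coeff_derivative, legendreConst]
    push_cast
    ring_nf
  · simp only [add_mul, mul_assoc, one_mul, map_add, coeff_C_mul, coeff_succ_X_mul,
      coeff_derivative, legendreConst]
    push_cast
    ring_nf

theorem radialSeries_ode (μ ν : ℂ) (n : ℕ) :
    (2 * X + X ^ 2) * derivative ℂ (derivative ℂ (radialSeries μ ν n)) +
      C (2 * (n + μ + 1)) * ((1 + X) * derivative ℂ (radialSeries μ ν n)) +
      C (legendreConst μ ν n) * radialSeries μ ν n = 0 := by
  ext i
  rw [coeff_legendreOp]
  have h := hypCoeff_succ (1 + μ + n + ν) (μ + n - ν) (1 + μ + n) i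
  simp only [radialSeries, coeff_mk, legendreConst, pow_succ]
  push_cast
  simp only [map_zero]
  linear_combination -(-1 / 2) ^ i * h

/-- With Q = 2X + X² one has Q' = 2(1+X) and (1+X)² = Q + 1. Conjugation by Q^(l+1) therefore turns
the order-j operator into the one of order j + 2(l+1), up to a multiple of Q^l. -/
theorem radialSeries_ode_pow (μ ν : ℂ) (j l : ℕ) :
    (2 * X + X ^ 2) * derivative ℂ (derivative ℂ
        ((2 * X + X ^ 2) ^ (l + 1) * radialSeries μ ν (j + 2 * (l + 1)))) +
      C (2 * (j + μ + 1)) * ((1 + X) * derivative ℂ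
        ((2 * X + X ^ 2) ^ (l + 1) * radialSeries μ ν (j + 2 * (l + 1)))) +
      C (legendreConst μ ν j) *
        ((2 * X + X ^ 2) ^ (l + 1) * radialSeries μ ν (j + 2 * (l + 1))) =
      C (4 * (l + 1) * (j + l + 1 + μ)) *
        ((2 * X + X ^ 2) ^ l * radialSeries μ ν (j + 2 * (l + 1))) := by
  have hK := radialSeries_ode μ ν (j + 2 * (l + 1))
  set K := radialSeries μ ν (j + 2 * (l + 1))
  set Q : PowerSeries ℂ := 2 * X + X ^ 2 with hQ
  have dQ : derivative ℂ Q = 2 * (1 + X) := by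
    have h2 : (2 : PowerSeries ℂ) = C 2 := rfl
    rw [hQ, h2]
    simp [Derivation.leibniz, Derivation.leibniz_pow, derivative_C, derivative_X]
    rw [← h2]
    ring
  have d1X : derivative ℂ (2 * (1 + X) : PowerSeries ℂ) = 2 := by
    have h2 : (2 : PowerSeries ℂ) = C 2 := rfl
    rw [h2]
    simp [Derivation.leibniz, derivative_C, derivative_X]
  have dP : derivative ℂ (Q ^ (l + 1)) = C (l + 1 : ℂ) * (Q ^ l * (2 * (1 + X))) := by
    rw [Derivation.leibniz_pow, dQ]
    simp [nsmul_eq_mul]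
  have dl : Q * derivative ℂ (Q ^ l) = C (l : ℂ) * (Q ^ l * (2 * (1 + X))) := by
    rw [Derivation.leibniz_pow, dQ]
    rcases l with _ | l
    · simp
    · simp [nsmul_eq_mul, pow_succ]
      ring
  have dC : derivative ℂ (C (l : ℂ) : PowerSeries ℂ) = 0 := derivative_C
  have d1 : derivative ℂ (1 : PowerSeries ℂ) = 0 := derivative_C (r := (1 : ℂ))
  simp only [Derivation.leibniz, smul_eq_mul, map_add, dP, d1X]
  rw [show legendreConst μ ν (j + 2 * (l + 1)) = legendreConst μ ν j +
    2 * (l + 1) * (2 * j + 2 * (l + 1) + 2 * μ + 1) by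
      simp only [legendreConst]; push_cast; ring] at hK
  push_cast at hK
  simp only [map_add, map_mul] at hK ⊢
  have c2 : (C 2 : PowerSeries ℂ) = 2 := rfl
  have c4 : (C 4 : PowerSeries ℂ) = 4 := rfl
  have c1 : (C 1 : PowerSeries ℂ) = 1 := rfl
  simp only [c1, c2, c4, dC, d1] at hK ⊢
  have hx : (1 + X : PowerSeries ℂ) ^ 2 = Q + 1 := by rw [hQ]; ring
  linear_combination Q ^ (l + 1) * hK + K * (C (l : ℂ) + 1) * 2 * (1 + X) * dl +
    (C (l : ℂ) + 1) * 4 * (C (l : ℂ) + C (j : ℂ) + C μ + 1) * K * Q ^ l * hx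

/-- The remainder left by `radialSeries_ode_pow` at (j, l+1) cancels the second y-derivative at
(j+2, l); both indices belong to the same n = j + 2(l+1). -/
theorem gegenbauerHom_ode (μ : ℂ) (j l : ℕ) :
    4 * (l + 1) * (j + l + 1 + μ) * gegenbauerHom μ j (l + 1) +
      (j + 2) * (j + 1) * gegenbauerHom μ (j + 2) l = 0 := by
  have h1 : (j.factorial : ℂ) ≠ 0 := by exact_mod_cast j.factorial_ne_zero
  have h2 : (j + 1 : ℂ) ≠ 0 := by exact_mod_cast j.succ_ne_zero
  have h3 : (l.factorial : ℂ) ≠ 0 := by exact_mod_cast l.factorial_ne_zero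
  have h4 : (l + 1 : ℂ) ≠ 0 := by exact_mod_cast l.succ_ne_zero
  have h5 : (j + 2 : ℂ) ≠ 0 := by exact_mod_cast (j + 1).succ_ne_zero
  have f2 : ((j + 2).factorial : ℂ) = (j + 2) * ((j + 1) * j.factorial) := by
    rw [Nat.factorial_succ, Nat.factorial_succ]; push_cast; ring
  have p1 : poch μ (j + 2 + l) = poch μ (j + (l + 1)) * (j + l + 1 + μ) := by
    rw [show j + 2 + l = j + (l + 1) + 1 by ring, poch_succ]; push_cast; ring
  simp only [gegenbauerHom, p1]
  rw [f2, Nat.factorial_succ]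
  simp only [pow_succ]
  push_cast
  field_simp
  ring

/-- The coefficient of `X ^ i * y ^ j` in `∑ₙ Bₙ Kₙ(X) Rₙ(y, 2X + X²)`, with `Kₙ` the radial series
and `Rₙ` the homogeneous Gegenbauer polynomials. -/
noncomputable def expansionCoeff (μ ν : ℂ) (B : ℕ → ℂ) (i j : ℕ) : ℂ :=
  ∑ l ∈ Finset.range (i + 1), B (j + 2 * l) * gegenbauerHom μ j l *
    coeff i ((2 * X + X ^ 2) ^ l * radialSeries μ ν (j + 2 * l))

theorem coeff_pow_mul_of_lt {i l : ℕ} (h : i < l) (f : PowerSeries ℂ) :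
    coeff i ((2 * X + X ^ 2) ^ l * f) = 0 := by
  rw [show (2 * X + X ^ 2 : PowerSeries ℂ) = X * (2 + X) by ring, mul_pow, mul_assoc,
    coeff_X_pow_mul', if_neg (by omega)]

/-- This holds for arbitrary weights B, since each separated solution satisfies it alone. The
summand l = 0 is the radial equation; every other one is paired with its neighbour by
`gegenbauerHom_ode`. -/
theorem expansionCoeff_recurrence (μ ν : ℂ) (B : ℕ → ℂ) (i j : ℕ) :
    2 * (i + 1) * (i + j + 1 + μ) * expansionCoeff μ ν B (i + 1) j +
      (j + 2) * (j + 1) * expansionCoeff μ ν B i (j + 2) +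
      legendreConst μ ν (i + j) * expansionCoeff μ ν B i j = 0 := by
  have e0 : expansionCoeff μ ν B i j = ∑ l ∈ Finset.range (i + 1 + 1),
      B (j + 2 * l) * gegenbauerHom μ j l *
      coeff i ((2 * X + X ^ 2) ^ l * radialSeries μ ν (j + 2 * l)) := by
    rw [Finset.sum_range_succ _ (i + 1), coeff_pow_mul_of_lt (by omega), mul_zero, add_zero]
    rfl
  rw [e0, expansionCoeff, expansionCoeff, Finset.sum_range_succ', Finset.sum_range_succ' _ (i + 1)]
  have h0 := congrArg (coeff i) (radialSeries_ode μ ν j)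
  rw [coeff_legendreOp, map_zero] at h0
  have hs : ∑ l ∈ Finset.range (i + 1), (2 * (i + 1) * (i + j + 1 + μ) *
        (B (j + 2 * (l + 1)) * gegenbauerHom μ j (l + 1) * coeff (i + 1)
          ((2 * X + X ^ 2) ^ (l + 1) * radialSeries μ ν (j + 2 * (l + 1)))) +
      (j + 2) * (j + 1) * (B (j + 2 + 2 * l) * gegenbauerHom μ (j + 2) l *
        coeff i ((2 * X + X ^ 2) ^ l * radialSeries μ ν (j + 2 + 2 * l))) +
      legendreConst μ ν (i + j) * (B (j + 2 * (l + 1)) * gegenbauerHom μ j (l + 1) *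
        coeff i ((2 * X + X ^ 2) ^ (l + 1) * radialSeries μ ν (j + 2 * (l + 1))))) = 0 := by
    refine Finset.sum_eq_zero fun l _ => ?_
    have h := congrArg (coeff i) (radialSeries_ode_pow μ ν j l)
    rw [coeff_legendreOp, coeff_C_mul] at h
    have hh := gegenbauerHom_ode μ j l
    rw [show j + 2 + 2 * l = j + 2 * (l + 1) by ring]
    linear_combination B (j + 2 * (l + 1)) * gegenbauerHom μ j (l + 1) * h +
      B (j + 2 * (l + 1)) * coeff i ((2 * X + X ^ 2) ^ l * radialSeries μ ν (j + 2 * (l + 1))) * hh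
  rw [Finset.sum_add_distrib, Finset.sum_add_distrib, ← Finset.mul_sum, ← Finset.mul_sum,
    ← Finset.mul_sum] at hs
  simp only [pow_zero, one_mul, mul_zero, add_zero]
  linear_combination hs + B j * gegenbauerHom μ j 0 * h0

theorem add_natCast_ne_zero {μ : ℂ} (hμ : -(1 / 2 : ℝ) < μ.re) (hμ0 : μ ≠ 0) (n : ℕ) :
    μ + n ≠ 0 := by
  rcases n with _ | n
  · simpa using hμ0
  · intro h
    have := congrArg Complex.re h
    simp at this
    have hn : (0 : ℝ) ≤ n := n.cast_nonneg
    norm_num at hμ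
    linarith

theorem half_lt_re {μ : ℂ} (hμ : -(1 / 2 : ℝ) < μ.re) (n : ℕ) : 1 / 2 < (1 + μ + n).re := by
  simp
  have hn : (0 : ℝ) ≤ n := n.cast_nonneg
  norm_num at hμ ⊢
  linarith

theorem Gamma_one_add_ne_zero {μ : ℂ} (hμ : -(1 / 2 : ℝ) < μ.re) (n : ℕ) :
    Complex.Gamma (1 + μ + n) ≠ 0 :=
  Complex.Gamma_ne_zero_of_re_pos (by linarith [half_lt_re hμ n])

/-- The coefficient of the `n`-th term of the addition theorem. -/
noncomputable def additionCoeff (μ s : ℂ) (φ : ℕ → ℂ) (n : ℕ) : ℂ :=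
  Complex.Gamma (1 + μ + n) * (-s) ^ n * φ n / (2 ^ n * poch μ n)

/-- The recurrence computes row i + 1 from row i because i + j + 1 + μ ≠ 0. In row 0 only l = 0
survives, and `additionCoeff` is chosen to make that row agree. -/
theorem expansionCoeff_eq_taylorCoeff {μ ν c s : ℂ} {φ : ℕ → ℂ} (hμ : -(1 / 2 : ℝ) < μ.re)
    (hμ0 : μ ≠ 0)
    (hφ : ∀ m : ℕ, s ^ 2 * φ (m + 2) + 2 * (μ + m + 1) * c * φ (m + 1) +
      legendreConst μ ν m * φ m = 0) (i j : ℕ) :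
    expansionCoeff μ ν (additionCoeff μ s φ) i j = taylorCoeff c s φ i j := by
  induction i generalizing j with
  | zero =>
    have h1 := Gamma_one_add_ne_zero hμ j
    have h2 := poch_ne_zero (add_natCast_ne_zero hμ hμ0) j
    have h3 : (j.factorial : ℂ) ≠ 0 := by exact_mod_cast j.factorial_ne_zero
    simp only [expansionCoeff, taylorCoeff, additionCoeff, gegenbauerHom, radialSeries,
      Finset.sum_range_one, zero_add, mul_zero, add_zero, pow_zero, one_mul, coeff_mk,
      hypCoeff_zero, Nat.factorial_zero, Nat.cast_one, mul_one]
    field_simp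
  | succ i ih =>
    have h1 := expansionCoeff_recurrence μ ν (additionCoeff μ s φ) i j
    have h2 := taylorCoeff_recurrence hφ i j
    rw [ih, ih] at h1
    have h3 : (i + 1 : ℂ) ≠ 0 := by exact_mod_cast i.succ_ne_zero
    have h4 : (i + j + 1 + μ : ℂ) ≠ 0 := by
      have := add_natCast_ne_zero hμ hμ0 (i + j + 1)
      push_cast at this
      rwa [add_comm] at this
    refine mul_left_cancel₀ (mul_ne_zero (mul_ne_zero two_ne_zero h3) h4) ?_
    linear_combination h1 - h2

/-- Writing Q^l = X^l (2+X)^l splits the degree in X as l + k, which prepares an absolutely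
convergent triple series. -/
theorem expansionCoeff_eq_sum_antidiagonal (μ ν : ℂ) (B : ℕ → ℂ) (i j : ℕ) :
    expansionCoeff μ ν B i j = ∑ p ∈ Finset.HasAntidiagonal.antidiagonal i,
      B (j + 2 * p.1) * gegenbauerHom μ j p.1 *
        coeff p.2 ((2 + X) ^ p.1 * radialSeries μ ν (j + 2 * p.1)) := by
  rw [Finset.Nat.sum_antidiagonal_eq_sum_range_succ_mk, expansionCoeff]
  refine Finset.sum_congr rfl fun l hl => ?_
  have : l ≤ i := Nat.lt_succ_iff.mp (Finset.mem_range.mp hl)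
  rw [show (2 * X + X ^ 2 : PowerSeries ℂ) = X * (2 + X) by ring, mul_pow, mul_assoc (X ^ l),
    coeff_X_pow_mul', if_pos this]

/-! ### Geometric bounds for the coefficients -/

theorem norm_poch_le {a : ℂ} {N : ℕ} (ha : ‖a‖ ≤ N) (i : ℕ) :
    ‖poch a i‖ ≤ i.factorial * 2 ^ (N + i) := by
  have h1 : ‖poch a i‖ ≤ ((N + 1).ascFactorial i : ℝ) := by
    induction i with
    | zero => simp [poch_zero]
    | succ i ih =>
      rw [poch_succ, Nat.ascFactorial_succ, norm_mul, mul_comm, Nat.cast_mul]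
      have : ‖a + i‖ ≤ ((N + 1 + i : ℕ) : ℝ) := by
        refine (norm_add_le _ _).trans ?_
        rw [Complex.norm_natCast]
        push_cast
        linarith
      gcongr
  refine h1.trans ?_
  rw [Nat.ascFactorial_eq_factorial_mul_choose]
  exact_mod_cast Nat.mul_le_mul_left _ (Nat.choose_le_two_pow _ _)

/-- Every factor 1 + μ + n + i has modulus at least 1/2, so adding ν multiplies it by at most 1 +
2‖ν‖. -/
theorem norm_poch_add_le {μ : ℂ} (hμ : -(1 / 2 : ℝ) < μ.re) (ν : ℂ) (n i : ℕ) :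
    ‖poch (1 + μ + n + ν) i‖ ≤ (1 + 2 * ‖ν‖) ^ i * ‖poch (1 + μ + n) i‖ := by
  induction i with
  | zero => simp [poch_zero]
  | succ i ih =>
    rw [poch_succ, poch_succ, norm_mul, norm_mul, pow_succ]
    have h1 : 1 / 2 ≤ ‖1 + μ + n + i‖ := by
      have h2 := half_lt_re hμ (n + i)
      push_cast at h2
      rw [← add_assoc] at h2
      exact h2.le.trans (Complex.re_le_norm _)
    have h2 : ‖1 + μ + n + ν + i‖ ≤ (1 + 2 * ‖ν‖) * ‖1 + μ + n + i‖ := by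
      have h3 : 1 + μ + n + ν + i = (1 + μ + n + i) + ν := by ring
      rw [h3]
      refine (norm_add_le _ _).trans ?_
      nlinarith [norm_nonneg ν]
    calc _ ≤ ((1 + 2 * ‖ν‖) ^ i * ‖poch (1 + μ + n) i‖) *
        ((1 + 2 * ‖ν‖) * ‖1 + μ + n + i‖) := by gcongr
      _ = _ := by ring

theorem norm_Gamma_mul_coeff_radialSeries_le {μ : ℂ} (hμ : -(1 / 2 : ℝ) < μ.re) (ν : ℂ) {N : ℕ}
    (hN : ‖μ - ν‖ ≤ N) (n i : ℕ) :
    ‖Complex.Gamma (1 + μ + n) * coeff i (radialSeries μ ν n)‖ ≤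
      2 ^ (N + n) * (1 + 2 * ‖ν‖) ^ i := by
  have hp : poch (1 + μ + n) i ≠ 0 := poch_ne_zero (fun k => by
    intro h
    have h2 := half_lt_re hμ (n + k)
    push_cast at h2
    rw [← add_assoc, h] at h2
    norm_num at h2) i
  have hG := Gamma_one_add_ne_zero hμ n
  have h3 : (i.factorial : ℝ) ≠ 0 := by exact_mod_cast i.factorial_ne_zero
  have e : Complex.Gamma (1 + μ + n) * coeff i (radialSeries μ ν n) =
      poch (1 + μ + n + ν) i / poch (1 + μ + n) i * (poch (μ + n - ν) i / i.factorial) *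
        (-1 / 2) ^ i := by
    have h := poch_mul_inv_Gamma (1 + μ + n) i
    have h' : (Complex.Gamma (1 + μ + n + i))⁻¹ =
        (Complex.Gamma (1 + μ + n))⁻¹ / poch (1 + μ + n) i := by
      rw [eq_div_iff hp, ← h]
      ring
    rw [radialSeries, coeff_mk, hypCoeff, h']
    field_simp
  have h1 : ‖poch (1 + μ + n + ν) i / poch (1 + μ + n) i‖ ≤ (1 + 2 * ‖ν‖) ^ i := by
    rw [norm_div, div_le_iff₀ (norm_pos_iff.mpr hp)]
    exact norm_poch_add_le hμ ν n i
  have h2 : ‖poch (μ + n - ν) i / (i.factorial : ℂ)‖ ≤ 2 ^ (N + n + i) := by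
    rw [norm_div, Complex.norm_natCast, div_le_iff₀ (by positivity), mul_comm]
    refine norm_poch_le ?_ i
    rw [show μ + n - ν = μ - ν + n by ring]
    refine (norm_add_le _ _).trans ?_
    rw [Complex.norm_natCast]
    push_cast
    linarith
  rw [e, norm_mul, norm_mul]
  have h4 : ‖(-1 / 2 : ℂ) ^ i‖ = (1 / 2) ^ i := by simp
  rw [h4]
  calc _ ≤ (1 + 2 * ‖ν‖) ^ i * 2 ^ (N + n + i) * (1 / 2) ^ i := by gcongr
    _ = _ := by
      rw [pow_add 2 (N + n) i, one_div, inv_pow]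
      field_simp

theorem norm_coeff_pow_mul_le {f : PowerSeries ℂ} {M A : ℝ} (hA : 1 ≤ A) (hM : 0 ≤ M)
    (hf : ∀ k, ‖coeff k f‖ ≤ M * A ^ k) (l k : ℕ) :
    ‖coeff k ((2 + X) ^ l * f)‖ ≤ 3 ^ l * M * A ^ k := by
  induction l generalizing k with
  | zero => simpa using hf k
  | succ l ih =>
    have h2 : (2 : PowerSeries ℂ) = C 2 := rfl
    rw [pow_succ', mul_assoc, add_mul, map_add, h2, coeff_C_mul, ← h2]
    have hA0 : 0 ≤ A := zero_le_one.trans hA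
    rcases k with _ | k
    · rw [coeff_zero_X_mul, add_zero, norm_mul]
      have := ih 0
      simp only [pow_zero, mul_one] at this ⊢
      have h3 : (0 : ℝ) ≤ 3 ^ l * M := by positivity
      simp only [Complex.norm_ofNat]
      rw [pow_succ]
      linarith
    · rw [coeff_succ_X_mul]
      refine (norm_add_le _ _).trans ?_
      rw [norm_mul, Complex.norm_ofNat]
      have i1 := ih (k + 1)
      have i2 := ih k
      have h3 : (0 : ℝ) ≤ 3 ^ l * M * A ^ k := by positivity
      have h4 : 3 ^ l * M * A ^ k ≤ 3 ^ l * M * A ^ (k + 1) := by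
        rw [pow_succ A, ← mul_assoc]
        exact le_mul_of_one_le_right h3 hA
      rw [pow_succ (3 : ℝ)]
      linarith

/-- The quotient n!/(μ)_n is Γ(μ) times a coefficient of a regularized Gauss series with parameters
1, 1; μ, whose terms are bounded at any q < 1. -/
theorem exists_norm_factorial_div_poch_le {μ : ℂ} (hμ : -(1 / 2 : ℝ) < μ.re) (hμ0 : μ ≠ 0) {q : ℝ}
    (h0 : 0 < q) (h1 : q < 1) :
    ∃ C : ℝ, 0 ≤ C ∧ ∀ n : ℕ, ‖(n.factorial : ℂ) / poch μ n‖ * q ^ n ≤ C := by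
  obtain ⟨C, hC0, hC⟩ := exists_norm_hypCoeff_le 1 1 μ h0 h1
  refine ⟨C * ‖Complex.Gamma μ‖, by positivity, fun n => ?_⟩
  have h2 := poch_ne_zero (add_natCast_ne_zero hμ hμ0) n
  have hG : Complex.Gamma μ ≠ 0 := Complex.Gamma_ne_zero fun m h =>
    add_natCast_ne_zero hμ hμ0 m (by rw [h]; ring)
  have e : (n.factorial : ℂ) / poch μ n = hypCoeff 1 1 μ n * Complex.Gamma μ := by
    rw [div_eq_iff h2, hypCoeff_one]
    have := poch_mul_inv_Gamma μ n
    have h3 : poch 1 n = n.factorial := by simp [poch, ascPochhammer_eval_one]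
    rw [h3]
    linear_combination -(n.factorial * Complex.Gamma μ : ℂ) * this -
      (n.factorial : ℂ) * inv_mul_cancel₀ hG
  rw [e, norm_mul, mul_right_comm]
  exact mul_le_mul_of_nonneg_right (hC n) (norm_nonneg _)

end Germ

section Germ

open PowerSeries

theorem norm_gegenbauerHom_le {μ : ℂ} {N : ℕ} (hN : ‖μ‖ ≤ N) (j l : ℕ) :
    ‖gegenbauerHom μ j l‖ ≤ 2 ^ N * 8 ^ j * 4 ^ l := by
  have h1 : (j.factorial : ℝ) ≠ 0 := by exact_mod_cast j.factorial_ne_zero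
  have h2 : (l.factorial : ℝ) ≠ 0 := by exact_mod_cast l.factorial_ne_zero
  have hch : ((j + l).factorial : ℝ) / (l.factorial * j.factorial) ≤ 2 ^ (j + l) := by
    rw [div_le_iff₀ (by positivity)]
    have := Nat.add_choose_mul_factorial_mul_factorial j l
    have e : ((j + l).factorial : ℝ) = (j + l).choose l * j.factorial * l.factorial := by
      exact_mod_cast this.symm
    have h3 : (((j + l).choose l : ℕ) : ℝ) ≤ 2 ^ (j + l) := by
      exact_mod_cast Nat.choose_le_two_pow (j + l) l
    rw [e, mul_assoc, mul_comm (j.factorial : ℝ)]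
    gcongr
  have hp := norm_poch_le hN (j + l)
  rw [gegenbauerHom]
  simp only [norm_mul, norm_div, norm_pow, norm_neg, norm_one, one_pow, one_mul,
    Complex.norm_natCast, Complex.norm_ofNat]
  calc ‖poch μ (j + l)‖ * 2 ^ j / (l.factorial * j.factorial)
      ≤ ((j + l).factorial * 2 ^ (N + (j + l))) * 2 ^ j / (l.factorial * j.factorial) := by gcongr
    _ = ((j + l).factorial : ℝ) / (l.factorial * j.factorial) * (2 ^ (N + (j + l)) * 2 ^ j) := by
      ring
    _ ≤ 2 ^ (j + l) * (2 ^ (N + (j + l)) * 2 ^ j) := by gcongr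
    _ = 2 ^ N * 8 ^ j * 4 ^ l := by
      rw [show (8 : ℝ) = 2 * 2 * 2 by norm_num, show (4 : ℝ) = 2 * 2 by norm_num]
      simp only [mul_pow, pow_add]
      ring

/-- The terms of the expansion in powers of `X`, `2 + X` and `y`. -/
noncomputable def tripleCoeff (μ ν s : ℂ) (φ : ℕ → ℂ) (j l k : ℕ) : ℂ :=
  additionCoeff μ s φ (j + 2 * l) * gegenbauerHom μ j l *
    coeff k ((2 + X) ^ l * radialSeries μ ν (j + 2 * l))

theorem exists_norm_tripleCoeff_le {μ : ℂ} (hμ : -(1 / 2 : ℝ) < μ.re) (hμ0 : μ ≠ 0) (ν s : ℂ)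
    {φ : ℕ → ℂ} {C D : ℝ} (hD : 0 ≤ D) (hC : 0 ≤ C)
    (hφ : ∀ n, ‖φ n‖ ≤ C * D ^ n * n.factorial) :
    ∃ C' M : ℝ, 0 ≤ C' ∧ 1 ≤ M ∧
      ∀ j l k, ‖tripleCoeff μ ν s φ j l k‖ ≤ C' * (M ^ j * (M ^ l * M ^ k)) := by
  obtain ⟨N₁, hN₁⟩ := exists_nat_ge ‖μ‖
  obtain ⟨N₂, hN₂⟩ := exists_nat_ge ‖μ - ν‖
  obtain ⟨C₁, hC₁, h₁⟩ := exists_norm_factorial_div_poch_le hμ hμ0 (q := 1 / 2) (by norm_num)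
    (by norm_num)
  set A := 1 + 2 * ‖ν‖ with hA
  have hA1 : 1 ≤ A := by simp [hA]
  set S := 2 * ‖s‖ * D with hS
  have hS0 : 0 ≤ S := by positivity
  -- Collecting all powers of exponent n = j + 2l gives S^j (S²)^l. The Gegenbauer bound adds 8^j
  -- 4^l, the factor (2+X)^l adds 3^l, and the radial series adds A^k; M dominates 8S, 12S² and A at
  -- once.
  refine ⟨C * C₁ * 2 ^ N₁ * 2 ^ N₂, A + 8 * S + 12 * S ^ 2, by positivity, by nlinarith,
    fun j l k => ?_⟩
  set n := j + 2 * l with hn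
  have hf : (n.factorial : ℂ) ≠ 0 := by exact_mod_cast n.factorial_ne_zero
  have hf' : (0 : ℝ) < n.factorial := by exact_mod_cast n.factorial_pos
  have e : tripleCoeff μ ν s φ j l k = (-s) ^ n / 2 ^ n * (φ n / n.factorial) *
      (n.factorial / poch μ n) * gegenbauerHom μ j l *
      coeff k ((2 + X) ^ l * (PowerSeries.C (Complex.Gamma (1 + μ + n)) *
        radialSeries μ ν n)) := by
    rw [mul_left_comm, coeff_C_mul, tripleCoeff, ← hn, additionCoeff]
    field_simp
  have b1 : ‖(-s) ^ n / 2 ^ n‖ = (‖s‖ / 2) ^ n := by simp [div_pow]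
  have b2 : ‖φ n / n.factorial‖ ≤ C * D ^ n := by
    rw [norm_div, Complex.norm_natCast, div_le_iff₀ hf']
    exact hφ n
  have b3 : ‖(n.factorial : ℂ) / poch μ n‖ ≤ C₁ * 2 ^ n := by
    have := h₁ n
    rw [one_div, inv_pow, ← div_eq_mul_inv, div_le_iff₀ (by positivity)] at this
    exact this
  have b4 := norm_gegenbauerHom_le hN₁ j l
  have b5 := norm_coeff_pow_mul_le (f := PowerSeries.C (Complex.Gamma (1 + μ + n)) *
    radialSeries μ ν n) (M := 2 ^ (N₂ + n)) hA1 (by positivity)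
    (fun i => by
      rw [coeff_C_mul]
      exact norm_Gamma_mul_coeff_radialSeries_le hμ ν hN₂ n i) l k
  rw [e, norm_mul, norm_mul, norm_mul, norm_mul, b1]
  have m1 : A ≤ A + 8 * S + 12 * S ^ 2 := by nlinarith
  have m2 : 8 * S ≤ A + 8 * S + 12 * S ^ 2 := by nlinarith
  have m3 : 12 * S ^ 2 ≤ A + 8 * S + 12 * S ^ 2 := by nlinarith
  calc _ ≤ (‖s‖ / 2) ^ n * (C * D ^ n) * (C₁ * 2 ^ n) * (2 ^ N₁ * 8 ^ j * 4 ^ l) *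
        (3 ^ l * 2 ^ (N₂ + n) * A ^ k) := by gcongr
    _ = C * C₁ * 2 ^ N₁ * 2 ^ N₂ * ((8 * S) ^ j * ((12 * S ^ 2) ^ l * A ^ k)) := by
      have : (‖s‖ / 2) ^ n * D ^ n * 2 ^ n * 2 ^ n = S ^ j * (S ^ 2) ^ l := by
        rw [← pow_mul, ← pow_add, ← hn, ← mul_pow, ← mul_pow, ← mul_pow, hS]
        congr 1
        ring
      rw [pow_add 2 N₂ n, mul_pow 8 S, mul_pow 12, show (12 : ℝ) = 4 * 3 by norm_num, mul_pow 4 3]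
      linear_combination (C * C₁ * 2 ^ N₁ * 2 ^ N₂ * 8 ^ j * 4 ^ l * 3 ^ l * A ^ k) * this
    _ ≤ _ := by gcongr

/-! ### Convergence of the expansion near X = 0, y = 0 -/

theorem hasSum_coeff_pow_mul {f : PowerSeries ℂ} {z S : ℂ}
    (hf : HasSum (fun k => coeff k f * z ^ k) S) (l : ℕ) :
    HasSum (fun k => coeff k ((2 + X) ^ l * f) * z ^ k) ((2 + z) ^ l * S) := by
  induction l with
  | zero => simpa using hf
  | succ l ih =>
    set g := (2 + X) ^ l * f
    have hX : HasSum (fun k => coeff k (X * g) * z ^ k) (z * ((2 + z) ^ l * S)) := by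
      rw [← hasSum_nat_add_iff' 1]
      simp only [coeff_succ_X_mul, Finset.sum_range_one, coeff_zero_X_mul, zero_mul, sub_zero]
      refine (ih.mul_left z).congr_fun fun k => ?_
      rw [pow_succ]
      ring
    have h2 : ∀ k, coeff k (2 * g) = 2 * coeff k g := fun k => coeff_C_mul k g 2
    rw [pow_succ', mul_assoc, pow_succ', mul_assoc, add_mul 2 z]
    refine ((ih.mul_left 2).add hX).congr_fun fun k => ?_
    rw [add_mul, map_add, h2]
    ring

theorem hasSum_radialSeries (μ ν : ℂ) (n : ℕ) {z : ℂ} (hz : ‖z‖ < 1) :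
    HasSum (fun k => coeff k (radialSeries μ ν n) * z ^ k)
      (regHypSeries (1 + μ + n + ν) (μ + n - ν) (1 + μ + n) (-z / 2)) := by
  refine (hasSum_regHypSeries _ _ _ (-z / 2) ?_).congr_fun fun k => ?_
  · rw [norm_div, norm_neg, Complex.norm_ofNat]
    linarith [norm_nonneg z]
  · rw [radialSeries, coeff_mk, show -z / 2 = -1 / 2 * z by ring, mul_pow]
    ring

theorem summable_tripleCoeff {μ ν s : ℂ} {φ : ℕ → ℂ} {C M : ℝ} (hM : 1 ≤ M)
    (h : ∀ j l k, ‖tripleCoeff μ ν s φ j l k‖ ≤ C * (M ^ j * (M ^ l * M ^ k))) {z y : ℂ}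
    (hz : M * ‖z‖ < 1) (hy : M * ‖y‖ < 1) :
    Summable fun p : ℕ × ℕ × ℕ =>
      tripleCoeff μ ν s φ p.1 p.2.1 p.2.2 * z ^ (p.2.1 + p.2.2) * y ^ p.1 := by
  have hM0 : 0 ≤ M := zero_le_one.trans hM
  have gz := summable_geometric_of_lt_one (by positivity) hz
  have gy := summable_geometric_of_lt_one (by positivity) hy
  have hs := (gy.mul_of_nonneg (gz.mul_of_nonneg gz (fun _ => by positivity)
    (fun _ => by positivity)) (fun _ => by positivity) (fun _ => by positivity)).mul_left C
  refine Summable.of_norm_bounded hs fun ⟨j, l, k⟩ => ?_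
  simp only [norm_mul, norm_pow]
  calc _ ≤ C * (M ^ j * (M ^ l * M ^ k)) * ‖z‖ ^ (l + k) * ‖y‖ ^ j := by
        gcongr
        exact h j l k
    _ = _ := by
      simp only [mul_pow, pow_add]
      ring

theorem summable_taylorCoeff {c s : ℂ} {φ : ℕ → ℂ} {C D : ℝ} (hD : 0 ≤ D)
    (hφ : ∀ n, ‖φ n‖ ≤ C * D ^ n * n.factorial) {z y : ℂ}
    (hz : 2 * D * ‖c‖ * ‖z‖ < 1) (hy : 2 * D * ‖s‖ * ‖y‖ < 1) :
    Summable fun p : ℕ × ℕ => taylorCoeff c s φ p.2 p.1 * z ^ p.2 * y ^ p.1 := by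
  have gz := summable_geometric_of_lt_one (by positivity) hz
  have gy := summable_geometric_of_lt_one (by positivity) hy
  have hs := (gy.mul_of_nonneg gz (fun _ => by positivity) (fun _ => by positivity)).mul_left C
  have hC : 0 ≤ C := by
    have := (norm_nonneg _).trans (hφ 0)
    simpa using this
  refine Summable.of_norm_bounded hs fun ⟨j, i⟩ => ?_
  have hch : ((i + j).factorial : ℝ) / (i.factorial * j.factorial) ≤ 2 ^ (i + j) := by
    have h1 : (j.factorial : ℝ) ≠ 0 := by exact_mod_cast j.factorial_ne_zero
    have h2 : (i.factorial : ℝ) ≠ 0 := by exact_mod_cast i.factorial_ne_zero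
    rw [div_le_iff₀ (by positivity)]
    have e : ((i + j).factorial : ℝ) = (i + j).choose j * i.factorial * j.factorial := by
      exact_mod_cast (Nat.add_choose_mul_factorial_mul_factorial i j).symm
    have h3 : (((i + j).choose j : ℕ) : ℝ) ≤ 2 ^ (i + j) := by
      exact_mod_cast Nat.choose_le_two_pow (i + j) j
    rw [e, mul_assoc]
    gcongr
  rw [taylorCoeff]
  simp only [norm_mul, norm_div, norm_pow, norm_neg, Complex.norm_natCast]
  calc _ ≤ (C * D ^ (i + j) * (i + j).factorial) * ‖c‖ ^ i * ‖s‖ ^ j /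
        (i.factorial * j.factorial) * ‖z‖ ^ i * ‖y‖ ^ j := by
        gcongr
        exact hφ _
    _ = ((i + j).factorial : ℝ) / (i.factorial * j.factorial) *
        (C * D ^ (i + j) * ‖c‖ ^ i * ‖s‖ ^ j * ‖z‖ ^ i * ‖y‖ ^ j) := by ring
    _ ≤ 2 ^ (i + j) * (C * D ^ (i + j) * ‖c‖ ^ i * ‖s‖ ^ j * ‖z‖ ^ i * ‖y‖ ^ j) := by gcongr
    _ = _ := by
      simp only [mul_pow, pow_add]
      ring

/-- By the binomial theorem, the terms of total degree m recombine into the m-th Taylor term in the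
increment cz - sy. -/
theorem sum_antidiagonal_taylorCoeff (c s : ℂ) (φ : ℕ → ℂ) (z y : ℂ) (m : ℕ) :
    ∑ p ∈ Finset.HasAntidiagonal.antidiagonal m, taylorCoeff c s φ p.2 p.1 * z ^ p.2 * y ^ p.1 =
      φ m / m.factorial * (c * z - s * y) ^ m := by
  rw [show c * z - s * y = -s * y + c * z by ring, (Commute.all _ _).add_pow', Finset.mul_sum]
  refine Finset.sum_congr rfl fun p hp => ?_
  have hp' := Finset.HasAntidiagonal.mem_antidiagonal.mp hp
  subst hp'
  have h1 : (p.1.factorial : ℂ) ≠ 0 := by exact_mod_cast p.1.factorial_ne_zero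
  have h2 : (p.2.factorial : ℂ) ≠ 0 := by exact_mod_cast p.2.factorial_ne_zero
  have h4 : ((p.1 + p.2).factorial : ℂ) ≠ 0 := by exact_mod_cast (p.1 + p.2).factorial_ne_zero
  have e : ((p.1 + p.2).choose p.1 : ℂ) * p.1.factorial * p.2.factorial =
      (p.1 + p.2).factorial := by
    rw [Nat.choose_symm_add]
    exact_mod_cast Nat.add_choose_mul_factorial_mul_factorial p.1 p.2
  rw [taylorCoeff, add_comm p.2 p.1, nsmul_eq_mul, mul_pow, mul_pow]
  field_simp
  linear_combination -(φ (p.1 + p.2) * c ^ p.2 * (-s) ^ p.1 * z ^ p.2 * y ^ p.1) * e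

/-- Reindexing by (j, l) ↦ (j + 2l, l), which is injective; off its range `gegenbauerTerm` is 0 by
definition. -/
theorem tsum_eq_tsum_sum_gegenbauerTerm (μ y z : ℂ) (B : ℕ → ℂ)
    (hs : Summable fun p : ℕ × ℕ => B (p.1 + 2 * p.2) * gegenbauerHom μ p.1 p.2 *
      y ^ p.1 * z ^ p.2) :
    ∑' p : ℕ × ℕ, B (p.1 + 2 * p.2) * gegenbauerHom μ p.1 p.2 * y ^ p.1 * z ^ p.2 =
      ∑' n, B n * ∑ l ∈ Finset.range (n + 1), gegenbauerTerm μ y z n l := by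
  set g : ℕ × ℕ → ℂ := fun p => B p.1 * gegenbauerTerm μ y z p.1 p.2
  set f : ℕ × ℕ → ℕ × ℕ := fun p => (p.1 + 2 * p.2, p.2)
  have hf : Function.Injective f := by
    rintro ⟨a, b⟩ ⟨a', b'⟩ h
    simp only [f, Prod.mk.injEq] at h
    ext <;> simp <;> omega
  have hgf : (fun p : ℕ × ℕ => B (p.1 + 2 * p.2) * gegenbauerHom μ p.1 p.2 *
      y ^ p.1 * z ^ p.2) = g ∘ f := by
    funext p
    simp only [g, f, Function.comp, gegenbauerTerm]
    rw [if_pos (by omega), Nat.add_sub_cancel]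
    ring
  have h0 : ∀ p ∉ Set.range f, g p = 0 := by
    rintro ⟨n, l⟩ hp
    simp only [g, gegenbauerTerm]
    rw [if_neg, mul_zero]
    intro hl
    exact hp ⟨(n - 2 * l, l), by simp [f]; omega⟩
  rw [hgf] at hs
  have hg : Summable g := (hf.summable_iff h0).mp hs
  rw [hgf]
  refine (hf.tsum_eq (f := g) fun p hp => by_contra fun h => hp (h0 p h)).trans ?_
  rw [hg.tsum_prod]
  refine tsum_congr fun n => ?_
  rw [Finset.mul_sum]
  refine tsum_eq_sum fun l hl => ?_
  simp only [g, gegenbauerTerm]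
  rw [if_neg, mul_zero]
  simp at hl
  omega

/-- The addition theorem near `x = 1`, `y = 0`. -/
theorem exists_addition_germ {μ : ℂ} (hμ : -(1 / 2 : ℝ) < μ.re) (hμ0 : μ ≠ 0) (ν c s : ℂ)
    {φ : ℕ → ℂ} {C D : ℝ} (hD : 0 ≤ D) (hC : 0 ≤ C)
    (hb : ∀ n, ‖φ n‖ ≤ C * D ^ n * n.factorial)
    (hφ : ∀ m : ℕ, s ^ 2 * φ (m + 2) + 2 * (μ + m + 1) * c * φ (m + 1) +
      legendreConst μ ν m * φ m = 0) :
    ∃ δ : ℝ, 0 < δ ∧ ∀ z y : ℂ, ‖z‖ < δ → ‖y‖ < δ →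
      ∑' n : ℕ, additionCoeff μ s φ n *
          regHypSeries (1 + μ + n + ν) (μ + n - ν) (1 + μ + n) (-z / 2) *
          ∑ l ∈ Finset.range (n + 1), gegenbauerTerm μ y (2 * z + z ^ 2) n l =
        ∑' m : ℕ, φ m / m.factorial * (c * z - s * y) ^ m := by
  obtain ⟨C', M, hC', hM, hT⟩ := exists_norm_tripleCoeff_le hμ hμ0 ν s hD hC hb
  set δ := (M + 2 * D * ‖c‖ + 2 * D * ‖s‖)⁻¹ with hδ
  have hpos : 0 < M + 2 * D * ‖c‖ + 2 * D * ‖s‖ := by positivity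
  have small : ∀ {a : ℝ} {w : ℂ}, 0 ≤ a → a ≤ M + 2 * D * ‖c‖ + 2 * D * ‖s‖ → ‖w‖ < δ →
      a * ‖w‖ < 1 := by
    intro a w ha0 ha hw
    calc a * ‖w‖ ≤ (M + 2 * D * ‖c‖ + 2 * D * ‖s‖) * ‖w‖ := by gcongr
      _ < (M + 2 * D * ‖c‖ + 2 * D * ‖s‖) * δ := by gcongr
      _ = 1 := mul_inv_cancel₀ hpos.ne'
  have hc0 : 0 ≤ 2 * D * ‖c‖ := by positivity
  have hs0 : 0 ≤ 2 * D * ‖s‖ := by positivity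
  refine ⟨δ, by positivity, fun z y hz hy => ?_⟩
  have hz1 : ‖z‖ < 1 := by
    have := small (a := 1) zero_le_one (by linarith) hz
    linarith
  have sT := summable_tripleCoeff hM hT (small (by linarith) (by linarith) hz)
    (small (w := y) (by linarith) (by linarith) hy)
  have sF := summable_taylorCoeff (c := c) (s := s) hD hb (small hc0 (by linarith) hz)
    (small (w := y) hs0 (by linarith) hy)
  -- For fixed j, grouping the triple series by l + k = i gives the formal coefficients, hence the
  -- Taylor series.
  have e1 : ∑' p : ℕ × ℕ × ℕ,
      tripleCoeff μ ν s φ p.1 p.2.1 p.2.2 * z ^ (p.2.1 + p.2.2) * y ^ p.1 =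
      ∑' m : ℕ, φ m / m.factorial * (c * z - s * y) ^ m := by
    rw [sT.tsum_prod]
    trans ∑' p : ℕ × ℕ, taylorCoeff c s φ p.2 p.1 * z ^ p.2 * y ^ p.1
    · rw [sF.tsum_prod]
      refine tsum_congr fun j => ?_
      refine (tsum_eq_tsum_sum_antidiagonal (sT.prod_factor j)).trans ?_
      refine tsum_congr fun i => ?_
      dsimp only
      rw [← expansionCoeff_eq_taylorCoeff hμ hμ0 hφ, expansionCoeff_eq_sum_antidiagonal,
        Finset.sum_mul, Finset.sum_mul]
      refine Finset.sum_congr rfl fun p hp => ?_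
      rw [Finset.HasAntidiagonal.mem_antidiagonal.mp hp, tripleCoeff]
    · rw [tsum_eq_tsum_sum_antidiagonal sF]
      exact tsum_congr fun m => sum_antidiagonal_taylorCoeff c s φ z y m
  rw [← e1, ← (Equiv.prodAssoc ℕ ℕ ℕ).tsum_eq]
  have sT' := (Equiv.prodAssoc ℕ ℕ ℕ).summable_iff.mpr sT
  -- Summing the same triple series over k first restores the radial function and the power of 2z +
  -- z².
  have e2 : ∀ p : ℕ × ℕ, ∑' k, tripleCoeff μ ν s φ p.1 p.2 k * z ^ (p.2 + k) * y ^ p.1 =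
      (additionCoeff μ s φ (p.1 + 2 * p.2) *
        regHypSeries (1 + μ + (p.1 + 2 * p.2 : ℕ) + ν) (μ + (p.1 + 2 * p.2 : ℕ) - ν)
          (1 + μ + (p.1 + 2 * p.2 : ℕ)) (-z / 2)) * gegenbauerHom μ p.1 p.2 * y ^ p.1 *
        (2 * z + z ^ 2) ^ p.2 := by
    rintro ⟨j, l⟩
    have h := (hasSum_coeff_pow_mul (hasSum_radialSeries μ ν (j + 2 * l) hz1) l).mul_left
      (additionCoeff μ s φ (j + 2 * l) * gegenbauerHom μ j l * z ^ l * y ^ j)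
    rw [show (2 * z + z ^ 2 : ℂ) = z * (2 + z) by ring, mul_pow]
    refine (tsum_congr fun k => ?_).trans (h.tsum_eq.trans ?_)
    · simp only [tripleCoeff, pow_add]
      ring
    · ring
  have e3 := sT'.tsum_prod
  simp only [Function.comp, Equiv.prodAssoc_apply] at e3
  have sP := sT'.prod
  simp only [Function.comp, Equiv.prodAssoc_apply] at sP
  simp only [Equiv.prodAssoc_apply]
  rw [e3]
  simp only [e2] at sP ⊢
  exact (tsum_eq_tsum_sum_gegenbauerTerm μ y (2 * z + z ^ 2) (fun n => additionCoeff μ s φ n *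
    regHypSeries (1 + μ + n + ν) (μ + n - ν) (1 + μ + n) (-z / 2)) sP).symm

end Germ

/-! ### Bounds for the radial functions, uniform in n -/

/-- Since Re(1 + μ) > 0, the factor 1 + μ + n + i has modulus at least n; for large n the shift by 1
+ ν is relatively at most ε. -/
theorem norm_poch_sub_le {μ ν : ℂ} (hμ : -(1 / 2 : ℝ) < μ.re) {ε : ℝ} (hε : 0 < ε) {n : ℕ}
    (hn : ‖1 + ν‖ ≤ ε * n) (i : ℕ) :
    ‖poch (μ + n - ν) i‖ ≤ (1 + ε) ^ i * ‖poch (1 + μ + n) i‖ := by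
  induction i with
  | zero => simp [poch_zero]
  | succ i ih =>
    rw [poch_succ, poch_succ, norm_mul, norm_mul, pow_succ]
    have h1 : (n : ℝ) ≤ ‖1 + μ + n + i‖ := by
      refine le_trans ?_ (Complex.re_le_norm _)
      simp
      have hi : (0 : ℝ) ≤ i := i.cast_nonneg
      norm_num at hμ
      linarith
    have h2 : ‖μ + n - ν + i‖ ≤ (1 + ε) * ‖1 + μ + n + i‖ := by
      have h3 : μ + n - ν + i = (1 + μ + n + i) - (1 + ν) := by ring
      rw [h3]
      refine (norm_sub_le _ _).trans ?_
      nlinarith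
    calc _ ≤ ((1 + ε) ^ i * ‖poch (1 + μ + n) i‖) * ((1 + ε) * ‖1 + μ + n + i‖) := by gcongr
      _ = _ := by ring

theorem poch_one_add_ne_zero {μ : ℂ} (hμ : -(1 / 2 : ℝ) < μ.re) (n i : ℕ) :
    poch (1 + μ + n) i ≠ 0 :=
  poch_ne_zero (fun k => by
    intro h
    have h2 := half_lt_re hμ (n + k)
    push_cast at h2
    rw [← add_assoc, h] at h2
    norm_num at h2) i

theorem norm_Gamma_mul_hypCoeff_le {μ ν : ℂ} (hμ : -(1 / 2 : ℝ) < μ.re) {ε : ℝ} (hε : 0 < ε)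
    {n : ℕ} (hn : ‖1 + ν‖ ≤ ε * n) (i : ℕ) :
    ‖Complex.Gamma (1 + μ + n) * hypCoeff (μ + n - ν) (-ν) (1 + μ + n) i‖ ≤
      (1 + ε) ^ i * ‖hypCoeff (-ν) 1 1 i‖ := by
  have hp := poch_one_add_ne_zero hμ n i
  have hG := Gamma_one_add_ne_zero hμ n
  have e : Complex.Gamma (1 + μ + n) * hypCoeff (μ + n - ν) (-ν) (1 + μ + n) i =
      poch (μ + n - ν) i / poch (1 + μ + n) i * hypCoeff (-ν) 1 1 i := by
    have h := poch_mul_inv_Gamma (1 + μ + n) i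
    have h' : (Complex.Gamma (1 + μ + n + i))⁻¹ =
        (Complex.Gamma (1 + μ + n))⁻¹ / poch (1 + μ + n) i := by
      rw [eq_div_iff hp, ← h]
      ring
    rw [hypCoeff_one_one, hypCoeff, h']
    field_simp
  rw [e, norm_mul]
  gcongr
  rw [norm_div, div_le_iff₀ (norm_pos_iff.mpr hp)]
  exact norm_poch_sub_le hμ hε hn i

/-- The normalized radial functions are bounded on discs, uniformly in `n`. -/
theorem exists_norm_Gamma_mul_regHypSeries_le {μ : ℂ} (hμ : -(1 / 2 : ℝ) < μ.re) (ν : ℂ) {q : ℝ}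
    (h0 : 0 < q) (h1 : q < 1) :
    ∃ C : ℝ, 0 ≤ C ∧ ∀ (n : ℕ) (w : ℂ), ‖w‖ ≤ q →
      ‖Complex.Gamma (1 + μ + n) * regHypSeries (μ + n - ν) (-ν) (1 + μ + n) w‖ ≤ C := by
  have aux : ∀ (n : ℕ) (g : ℕ → ℝ), Summable g →
      (∀ i, ‖Complex.Gamma (1 + μ + n) * hypCoeff (μ + n - ν) (-ν) (1 + μ + n) i‖ * q ^ i ≤ g i) →
      ∀ w : ℂ, ‖w‖ ≤ q →
      ‖Complex.Gamma (1 + μ + n) * regHypSeries (μ + n - ν) (-ν) (1 + μ + n) w‖ ≤ ∑' i, g i := by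
    intro n g hg hle w hw
    rw [regHypSeries_eq_tsum, ← tsum_mul_left]
    refine tsum_of_norm_bounded hg.hasSum fun i => le_trans ?_ (hle i)
    rw [← mul_assoc, norm_mul, norm_pow]
    gcongr
  obtain ⟨p, hqp, hp1⟩ := exists_between h1
  have hp0 : 0 < p := h0.trans hqp
  -- Chosen so that (1 + ε)q = p < 1: the loss (1 + ε)^i is absorbed by enlarging the radius.
  set ε := p / q - 1 with hε
  have hε0 : 0 < ε := by
    rw [hε, sub_pos, lt_div_iff₀ h0]
    linarith
  have hεq : (1 + ε) * q = p := by
    rw [hε]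
    field_simp
    ring
  obtain ⟨N, hN⟩ := exists_nat_ge (‖1 + ν‖ / ε)
  have hbig := summable_norm_hypCoeff (-ν) 1 1 (p : ℂ) (by simpa [abs_of_pos hp0] using hp1)
  have hsmall : ∀ n : ℕ, Summable fun i =>
      ‖Complex.Gamma (1 + μ + n) * hypCoeff (μ + n - ν) (-ν) (1 + μ + n) i‖ * q ^ i := by
    intro n
    refine ((summable_norm_hypCoeff (μ + n - ν) (-ν) (1 + μ + n) (q : ℂ)
      (by simpa [abs_of_pos h0] using h1)).mul_left ‖Complex.Gamma (1 + μ + n)‖).congr fun i => ?_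
    rw [norm_mul, norm_mul, norm_pow, Complex.norm_real, Real.norm_eq_abs, abs_of_pos h0, mul_assoc]
  set K : ℕ → ℝ := fun n => ∑' i,
    ‖Complex.Gamma (1 + μ + n) * hypCoeff (μ + n - ν) (-ν) (1 + μ + n) i‖ * q ^ i
  have hK : ∀ n, 0 ≤ K n := fun n => tsum_nonneg fun i => by positivity
  have hB : 0 ≤ ∑' i, ‖hypCoeff (-ν) 1 1 i * (p : ℂ) ^ i‖ := tsum_nonneg fun i => norm_nonneg _
  have hS : 0 ≤ ∑ n ∈ Finset.range N, K n := Finset.sum_nonneg fun n _ => hK n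
  refine ⟨∑' i, ‖hypCoeff (-ν) 1 1 i * (p : ℂ) ^ i‖ + ∑ n ∈ Finset.range N, K n, by positivity,
    fun n w hw => ?_⟩
  -- The relative bound needs n ≥ N; the finitely many smaller n are covered by adding their own
  -- sums to the constant.
  rcases Nat.lt_or_ge n N with hn | hn
  · refine (aux n _ (hsmall n) (fun i => le_rfl) w hw).trans ?_
    have := Finset.single_le_sum (f := K) (fun n _ => hK n) (Finset.mem_range.mpr hn)
    change K n ≤ _
    linarith
  · have hn' : ‖1 + ν‖ ≤ ε * n := by
      have : (N : ℝ) ≤ n := by exact_mod_cast hn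
      rw [div_le_iff₀ hε0] at hN
      nlinarith
    refine (aux n _ hbig (fun i => ?_) w hw).trans (by linarith)
    calc _ ≤ ((1 + ε) ^ i * ‖hypCoeff (-ν) 1 1 i‖) * q ^ i := by
          gcongr
          exact norm_Gamma_mul_hypCoeff_le hμ hε0 hn' i
      _ = _ := by
        rw [norm_mul, norm_pow, Complex.norm_real, Real.norm_eq_abs, abs_of_pos hp0, ← hεq, mul_pow]
        ring

/-! ### Families with F_n' = F_{n+1}: Taylor series and Cauchy estimates -/

section Family

variable {F : ℕ → ℂ → ℂ}

theorem isOpen_one_lt_re : IsOpen {z : ℂ | 1 < z.re} :=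
  isOpen_lt continuous_const Complex.continuous_re

theorem iteratedDeriv_family (hF : ∀ n z, 1 < z.re → HasDerivAt (F n) (F (n + 1) z) z) (n : ℕ)
    {z : ℂ} (hz : 1 < z.re) : iteratedDeriv n (F 0) z = F n z := by
  induction n generalizing z with
  | zero => simp
  | succ n ih =>
    rw [iteratedDeriv_succ]
    have : iteratedDeriv n (F 0) =ᶠ[𝓝 z] F n := by
      filter_upwards [isOpen_one_lt_re.mem_nhds hz] with w hw
      exact ih hw
    rw [this.deriv_eq, (hF n z hz).deriv]

theorem ball_subset_one_lt_re (c : ℝ) : Metric.ball (c : ℂ) (c - 1) ⊆ {z : ℂ | 1 < z.re} := by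
  intro z hz
  rw [Metric.mem_ball, Complex.dist_eq] at hz
  have := (Complex.abs_re_le_norm (z - c)).trans_lt hz
  rw [abs_lt] at this
  simp at this
  change 1 < z.re
  linarith [this.1]

theorem differentiableOn_family (hF : ∀ n z, 1 < z.re → HasDerivAt (F n) (F (n + 1) z) z) (n : ℕ) :
    DifferentiableOn ℂ (F n) {z : ℂ | 1 < z.re} :=
  fun z hz => (hF n z hz).differentiableAt.differentiableWithinAt

/-- Cauchy's estimate, as F_n is the n-th derivative of F_0. The radius may approach c - 1, the
distance from c to the line Re z = 1; the sharp rate is needed for convergence up to u = v. -/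
theorem exists_norm_family_le (hF : ∀ n z, 1 < z.re → HasDerivAt (F n) (F (n + 1) z) z) {c R : ℝ}
    (hR : 0 < R) (hRc : R < c - 1) :
    ∃ C : ℝ, 0 ≤ C ∧ ∀ n, ‖F n c‖ ≤ C * (R⁻¹) ^ n * n.factorial := by
  have hsub : Metric.closedBall (c : ℂ) R ⊆ {z : ℂ | 1 < z.re} :=
    (Metric.closedBall_subset_ball hRc).trans (ball_subset_one_lt_re c)
  have hd := (differentiableOn_family hF 0).mono hsub
  obtain ⟨C, hC⟩ := (isCompact_closedBall (c : ℂ) R).exists_bound_of_continuousOn hd.continuousOn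
  have hC0 : 0 ≤ C := (norm_nonneg _).trans (hC c (Metric.mem_closedBall_self hR.le))
  refine ⟨C, hC0, fun n => ?_⟩
  have hcr : 1 < (c : ℂ).re := by simp; linarith
  rw [← iteratedDeriv_family hF n hcr]
  refine (Complex.norm_iteratedDeriv_le_of_forall_mem_sphere_norm_le n hR ?_
    fun z hz => hC z (Metric.sphere_subset_closedBall hz)).trans (le_of_eq ?_)
  · exact (hd.mono (by rw [closure_ball _ hR.ne'])).diffContOnCl
  · rw [inv_pow]
    field_simp

theorem tsum_family_taylor (hF : ∀ n z, 1 < z.re → HasDerivAt (F n) (F (n + 1) z) z) {c : ℝ}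
    (hc : 1 < c) {h : ℂ} (hh : ‖h‖ < c - 1) :
    ∑' m : ℕ, F m c / m.factorial * h ^ m = F 0 (c + h) := by
  have hs := Complex.hasSum_taylorSeries_on_ball (c := (c : ℂ)) (z := c + h)
    ((differentiableOn_family hF 0).mono (ball_subset_one_lt_re c))
    (by simpa [Complex.dist_eq] using hh)
  rw [← hs.tsum_eq]
  refine tsum_congr fun m => ?_
  rw [iteratedDeriv_family hF m (by simpa using hc)]
  simp
  ring

end Family

/-! ### Domination of the series and analytic continuation in tanh(r/2) -/

/-- The terms of the addition theorem as functions of `w = tanh (r / 2)`, up to a common factor. -/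
noncomputable def additionTerm (μ ν s : ℂ) (φ : ℕ → ℂ) (t : ℂ) (n : ℕ) (w : ℂ) : ℂ :=
  additionCoeff μ s φ n * gegenbauerC n μ t * (2 * w) ^ n *
    regHypSeries (μ + n - ν) (-ν) (1 + μ + n) (w ^ 2)

section Family

variable {F : ℕ → ℂ → ℂ}

theorem exists_summable_norm_additionTerm_le {μ : ℂ} (hμ : -(1 / 2 : ℝ) < μ.re) (hμ0 : μ ≠ 0)
    (ν : ℂ) (hF : ∀ n z, 1 < z.re → HasDerivAt (F n) (F (n + 1) z) z) {v c s τ : ℝ} (hv0 : 0 < v)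
    (hv1 : v < 1) (hc : 1 < c) (hs : s * v = c - 1) (γ : ℝ) (hτ0 : 0 < τ) (hτ : τ < v) :
    ∃ M : ℕ → ℝ, Summable M ∧ ∀ (n : ℕ) (w : ℂ), ‖w‖ ≤ τ →
      ‖additionTerm μ ν s (fun n => F n c) (Real.cos γ) n w‖ ≤ M n := by
  set θ := τ / v with hθ
  have hθ0 : 0 < θ := by positivity
  have hθ1 : θ < 1 := by rwa [hθ, div_lt_one hv0]
  -- Each of three estimates costs a factor q^(-n): the Cauchy radius, n!/(μ)_n and the Gegenbauer
  -- bound. With θ = 4q - 3 Bernoulli gives q³ > q⁴ ≥ θ, so the ratio θ/q³ stays below 1.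
  set q := 1 - (1 - θ) / 4 with hq
  have hq0 : 0 < q := by linarith
  have hq1 : q < 1 := by linarith
  have hq3 : θ < q ^ 3 := by
    have : θ = 4 * q - 3 := by rw [hq]; ring
    rw [this]
    nlinarith [mul_pos (sub_pos.mpr hq1) (sub_pos.mpr hq1), mul_pos hq0 hθ0]
  have hs0 : 0 < s := by
    by_contra h
    nlinarith
  obtain ⟨C₁, hC₁, h₁⟩ := exists_norm_family_le hF (c := c) (R := q * (c - 1))
    (mul_pos hq0 (by linarith)) (by nlinarith)
  obtain ⟨C₂, hC₂, h₂⟩ := exists_norm_factorial_div_poch_le hμ hμ0 hq0 hq1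
  obtain ⟨C₃, hC₃, h₃⟩ := exists_norm_gegenbauerC_le hμ γ hq0 hq1
  obtain ⟨C₄, hC₄, h₄⟩ := exists_norm_Gamma_mul_regHypSeries_le hμ ν (q := τ ^ 2) (by positivity)
    (by nlinarith)
  refine ⟨fun n => C₁ * C₂ * C₃ * C₄ * (θ / q ^ 3) ^ n,
    (summable_geometric_of_lt_one (by positivity)
      ((div_lt_one (by positivity)).mpr hq3)).mul_left _, fun n w hw => ?_⟩
  have hf : (n.factorial : ℂ) ≠ 0 := by exact_mod_cast n.factorial_ne_zero
  have hf' : (0 : ℝ) < n.factorial := by exact_mod_cast n.factorial_pos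
  have e : additionTerm μ ν s (fun n => F n c) (Real.cos γ) n w =
      (Complex.Gamma (1 + μ + n) * regHypSeries (μ + n - ν) (-ν) (1 + μ + n) (w ^ 2)) *
        ((-s) ^ n * w ^ n) * (F n c / n.factorial) * (n.factorial / poch μ n) *
        gegenbauerC n μ (Real.cos γ) := by
    rw [additionTerm, additionCoeff, mul_pow]
    field_simp
  have b1 : ‖F n c / n.factorial‖ ≤ C₁ * ((q * (c - 1))⁻¹) ^ n := by
    rw [norm_div, Complex.norm_natCast, div_le_iff₀ hf']
    exact h₁ n
  have b2 : ‖(n.factorial : ℂ) / poch μ n‖ ≤ C₂ / q ^ n := by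
    rw [le_div_iff₀ (by positivity)]
    exact h₂ n
  have b3 : ‖gegenbauerC n μ (Real.cos γ)‖ ≤ C₃ / q ^ n := by
    rw [le_div_iff₀ (by positivity)]
    exact h₃ n
  have b4 := h₄ n (w ^ 2) (by rw [norm_pow]; gcongr)
  have b5 : ‖(-(s : ℂ)) ^ n * w ^ n‖ ≤ s ^ n * τ ^ n := by
    rw [norm_mul, norm_pow, norm_pow, norm_neg, Complex.norm_real, Real.norm_eq_abs,
      abs_of_pos hs0]
    gcongr
  rw [e, norm_mul, norm_mul, norm_mul, norm_mul]
  calc _ ≤ C₄ * (s ^ n * τ ^ n) * (C₁ * ((q * (c - 1))⁻¹) ^ n) * (C₂ / q ^ n) * (C₃ / q ^ n) := by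
        gcongr
    _ = _ := by
      rw [hθ, ← hs]
      have : (q * (s * v))⁻¹ ^ n * s ^ n * τ ^ n / q ^ n / q ^ n = (τ / v / q ^ 3) ^ n := by
        rw [← mul_pow, ← mul_pow, ← div_pow, ← div_pow]
        congr 1
        field_simp
      beta_reduce
      rw [← this]
      ring

theorem differentiable_additionTerm (μ ν s : ℂ) (φ : ℕ → ℂ) (t : ℂ) (n : ℕ) :
    DifferentiableOn ℂ (additionTerm μ ν s φ t n) (Metric.ball 0 1) := by
  intro w hw
  have h : DifferentiableAt ℂ (regHypSeries (μ + n - ν) (-ν) (1 + μ + n)) (w ^ 2) := by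
    refine (differentiableOn_regHypSeries _ _ _).differentiableAt (Metric.isOpen_ball.mem_nhds ?_)
    rw [mem_ball_zero_iff] at hw ⊢
    rw [norm_pow]
    exact pow_lt_one₀ (norm_nonneg _) hw two_ne_zero
  have h' : DifferentiableAt ℂ
      (fun w : ℂ => regHypSeries (μ + n - ν) (-ν) (1 + μ + n) (w ^ 2)) w :=
    h.comp (f := fun w : ℂ => w ^ 2) w (by fun_prop)
  have h2 : DifferentiableAt ℂ (fun w : ℂ =>
      additionCoeff μ s φ n * gegenbauerC n μ t * (2 * w) ^ n) w := by fun_prop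
  exact (h2.mul h').differentiableWithinAt

theorem differentiableOn_tsum_additionTerm {μ : ℂ} (hμ : -(1 / 2 : ℝ) < μ.re) (hμ0 : μ ≠ 0)
    (ν : ℂ) (hF : ∀ n z, 1 < z.re → HasDerivAt (F n) (F (n + 1) z) z) {v c s : ℝ} (hv0 : 0 < v)
    (hv1 : v < 1) (hc : 1 < c) (hs : s * v = c - 1) (γ : ℝ) :
    DifferentiableOn ℂ (fun w => ∑' n, additionTerm μ ν s (fun n => F n c) (Real.cos γ) n w)
      (Metric.ball 0 v) := by
  intro w hw
  rw [mem_ball_zero_iff] at hw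
  obtain ⟨τ, hwτ, hτv⟩ := exists_between hw
  obtain ⟨M, hM, hle⟩ := exists_summable_norm_additionTerm_le hμ hμ0 ν hF hv0 hv1 hc hs γ
    ((norm_nonneg w).trans_lt hwτ) hτv
  have hd := Complex.differentiableOn_tsum_of_summable_norm hM (U := Metric.ball 0 τ)
    (fun n => (differentiable_additionTerm μ ν s (fun n => F n c) (Real.cos γ) n).mono
      (Metric.ball_subset_ball (hτv.trans hv1).le)) Metric.isOpen_ball
    (fun n w hw => hle n w (mem_ball_zero_iff.mp hw).le)
  exact (hd.differentiableAt
    (Metric.isOpen_ball.mem_nhds (mem_ball_zero_iff.mpr hwτ))).differentiableWithinAt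

/-- `cosh ρ` as a function of `w = tanh (r / 2)`. -/
noncomputable def coshRho (c s t w : ℂ) : ℂ :=
  c + (c * (2 * w ^ 2 / (1 - w ^ 2)) - s * (2 * w / (1 - w ^ 2) * t))

/-- In the Poincaré disc, cosh ρ - 1 = 2(u² + v² - 2uv cos γ)/((1-u²)(1-v²)), and the numerator
factor is at least (v - |u|)² > 0. -/
theorem one_lt_coshRho {v u γ : ℝ} (hv1 : v < 1) (hu : |u| < v) :
    1 < (coshRho (((1 + v ^ 2) / (1 - v ^ 2) : ℝ) : ℂ) ((2 * v / (1 - v ^ 2) : ℝ) : ℂ)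
      (Real.cos γ) u).re := by
  have hv0 : 0 < v := (abs_nonneg u).trans_lt hu
  have h1 : 0 < 1 - v ^ 2 := by nlinarith
  have hu2 : u ^ 2 < v ^ 2 := by
    rw [← sq_abs u]
    exact pow_lt_pow_left₀ hu (abs_nonneg u) two_ne_zero
  have h2 : 0 < 1 - u ^ 2 := by linarith
  have e : coshRho (((1 + v ^ 2) / (1 - v ^ 2) : ℝ) : ℂ) ((2 * v / (1 - v ^ 2) : ℝ) : ℂ)
      (Real.cos γ) u = ((1 + 2 * (u ^ 2 + v ^ 2 - 2 * u * v * Real.cos γ) /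
        ((1 - u ^ 2) * (1 - v ^ 2)) : ℝ) : ℂ) := by
    rw [coshRho]
    have e' : (1 + v ^ 2) / (1 - v ^ 2) + ((1 + v ^ 2) / (1 - v ^ 2) * (2 * u ^ 2 / (1 - u ^ 2)) -
        2 * v / (1 - v ^ 2) * (2 * u / (1 - u ^ 2) * Real.cos γ)) =
        1 + 2 * (u ^ 2 + v ^ 2 - 2 * u * v * Real.cos γ) / ((1 - u ^ 2) * (1 - v ^ 2)) := by
      field_simp
      ring
    rw [← e']
    push_cast
    ring
  rw [e, Complex.ofReal_re]
  have h3 : 0 < u ^ 2 + v ^ 2 - 2 * u * v * Real.cos γ := by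
    have h4 : u * v * Real.cos γ ≤ |u| * v := by
      refine (le_abs_self _).trans ?_
      rw [abs_mul, abs_mul, abs_of_pos hv0]
      exact mul_le_of_le_one_right (by positivity) (Real.abs_cos_le_one γ)
    have h5 : 0 < (v - |u|) ^ 2 := by
      have : 0 < v - |u| := by linarith
      positivity
    rw [sub_sq, sq_abs] at h5
    nlinarith
  have : 0 < 2 * (u ^ 2 + v ^ 2 - 2 * u * v * Real.cos γ) / ((1 - u ^ 2) * (1 - v ^ 2)) := by
    positivity
  linarith

theorem one_sub_sq_ne_zero {w : ℂ} (hw : ‖w‖ < 1) : 1 - w ^ 2 ≠ 0 := by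
  intro h
  have h1 : w ^ 2 = 1 := (sub_eq_zero.mp h).symm
  have h2 : ‖w‖ ^ 2 = 1 := by rw [← norm_pow, h1, norm_one]
  nlinarith [norm_nonneg w]

theorem analyticAt_comp_ofReal {g : ℂ → ℂ} {x : ℝ} (hg : AnalyticAt ℂ g x) :
    AnalyticAt ℝ (fun x : ℝ => g x) x :=
  (hg.restrictScalars (𝕜 := ℝ)).comp (f := fun x : ℝ => (x : ℂ)) (Complex.ofRealCLM.analyticAt x)

theorem regHypSeries_radial_eq (μ ν : ℂ) (n : ℕ) {u : ℝ} (hu : |u| < 1 / 2) :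
    regHypSeries (1 + μ + n + ν) (μ + n - ν) (1 + μ + n) (-(2 * (u : ℂ) ^ 2 / (1 - u ^ 2)) / 2) =
      (1 - (u : ℂ) ^ 2) ^ (μ - ν) * (1 - (u : ℂ) ^ 2) ^ n *
        regHypSeries (μ + n - ν) (-ν) (1 + μ + n) ((u : ℂ) ^ 2) := by
  have hu2 : u ^ 2 < 1 / 4 := by
    rw [← sq_abs u]
    nlinarith [abs_nonneg u]
  have h1 : 0 < 1 - u ^ 2 := by linarith
  have h1c : (1 - (u : ℂ) ^ 2) = ((1 - u ^ 2 : ℝ) : ℂ) := by push_cast; ring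
  have h1n : (1 - (u : ℂ) ^ 2) ≠ 0 := by
    rw [h1c]
    exact_mod_cast h1.ne'
  have hw : -(2 * (u : ℂ) ^ 2 / (1 - u ^ 2)) / 2 = ((-(u ^ 2 / (1 - u ^ 2)) : ℝ) : ℂ) := by
    push_cast
    field_simp
  have hb : u ^ 2 / (1 - u ^ 2) < 1 := by
    rw [div_lt_one h1]
    linarith
  have hb0 : 0 ≤ u ^ 2 / (1 - u ^ 2) := by positivity
  rw [regHypSeries_eq_tsum]
  -- The upper parameters are exchanged so that Pfaff's new parameter c - b equals -ν, independent
  -- of n; the argument becomes u².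
  simp only [hypCoeff_symm (1 + μ + n + ν)]
  rw [← regHypSeries_eq_tsum, regHypSeries_eq_pfaffHyp, pfaffHyp]
  · have e1 : 1 - -(2 * (u : ℂ) ^ 2 / (1 - u ^ 2)) / 2 = (((1 - u ^ 2)⁻¹ : ℝ) : ℂ) := by
      push_cast
      field_simp
      ring
    have e2 : -(2 * (u : ℂ) ^ 2 / (1 - u ^ 2)) / 2 / (-(2 * (u : ℂ) ^ 2 / (1 - u ^ 2)) / 2 - 1) =
        (u : ℂ) ^ 2 := by
      rw [← neg_sub 1, e1]
      push_cast
      field_simp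
    rw [e2, e1, show 1 + μ + n - (1 + μ + n + ν) = -ν by ring]
    congr 1
    rw [Complex.ofReal_inv, Complex.inv_cpow, ← Complex.cpow_neg, neg_neg, ← h1c,
      show μ + n - ν = μ - ν + n by ring, Complex.cpow_add _ _ h1n, Complex.cpow_natCast]
    rw [Complex.arg_ofReal_of_nonneg h1.le]
    exact Real.pi_pos.ne
  · rw [hw, Complex.norm_real, Real.norm_eq_abs, abs_neg, abs_of_nonneg hb0]
    exact hb
  · rw [hw, Complex.ofReal_re]
    linarith

/-- The local identity at z = cosh r - 1 = 2u²/(1-u²) and y = 2ut/(1-u²), where 2z + z² = sinh² r is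
a perfect square in u. -/
theorem addition_eventuallyEq {μ : ℂ} (hμ : -(1 / 2 : ℝ) < μ.re) (hμ0 : μ ≠ 0) {ν : ℂ}
    (hF : ∀ n z, 1 < z.re → HasDerivAt (F n) (F (n + 1) z) z) {c s : ℝ} (hc : 1 < c)
    (hode : ∀ n : ℕ, (s : ℂ) ^ 2 * F (n + 2) c + 2 * (μ + n + 1) * c * F (n + 1) c +
      legendreConst μ ν n * F n c = 0) (t : ℂ) :
    (fun u : ℝ => F 0 (coshRho c s t u)) =ᶠ[𝓝 0] fun u : ℝ =>
      (1 - (u : ℂ) ^ 2) ^ (μ - ν) * ∑' n, additionTerm μ ν s (fun n => F n c) t n u := by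
  obtain ⟨C, hC, hb⟩ := exists_norm_family_le hF (c := c) (R := (c - 1) / 2) (by linarith)
    (by linarith)
  obtain ⟨δ, hδ, h⟩ := exists_addition_germ hμ hμ0 ν c s (by
    have : 0 < c - 1 := by linarith
    positivity) hC hb hode
  have ht1 : Filter.Tendsto (fun u : ℝ => ‖2 * (u : ℂ) ^ 2 / (1 - (u : ℂ) ^ 2)‖) (𝓝 0) (𝓝 0) := by
    have : ContinuousAt (fun u : ℝ => ‖2 * (u : ℂ) ^ 2 / (1 - (u : ℂ) ^ 2)‖) 0 := by
      refine ContinuousAt.norm (ContinuousAt.div (by fun_prop) (by fun_prop) (by simp))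
    simpa [ContinuousAt] using this
  have ht2 : Filter.Tendsto (fun u : ℝ => ‖2 * (u : ℂ) / (1 - (u : ℂ) ^ 2) * t‖)
      (𝓝 0) (𝓝 0) := by
    have : ContinuousAt (fun u : ℝ => ‖2 * (u : ℂ) / (1 - (u : ℂ) ^ 2) * t‖) 0 := by
      refine ContinuousAt.norm (ContinuousAt.mul (ContinuousAt.div (by fun_prop) (by fun_prop)
        (by simp)) (by fun_prop))
    simpa [ContinuousAt] using this
  have ht3 : Filter.Tendsto (fun u : ℝ => ‖(c : ℂ) * (2 * (u : ℂ) ^ 2 / (1 - (u : ℂ) ^ 2)) -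
      s * (2 * (u : ℂ) / (1 - (u : ℂ) ^ 2) * t)‖) (𝓝 0) (𝓝 0) := by
    have : ContinuousAt (fun u : ℝ => ‖(c : ℂ) * (2 * (u : ℂ) ^ 2 / (1 - (u : ℂ) ^ 2)) -
        s * (2 * (u : ℂ) / (1 - (u : ℂ) ^ 2) * t)‖) 0 := by
      refine ContinuousAt.norm (ContinuousAt.sub (ContinuousAt.mul (by fun_prop)
        (ContinuousAt.div (by fun_prop) (by fun_prop) (by simp))) (ContinuousAt.mul (by fun_prop)
        (ContinuousAt.mul (ContinuousAt.div (by fun_prop) (by fun_prop) (by simp))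
          (by fun_prop))))
    simpa [ContinuousAt] using this
  have ht4 : ∀ᶠ u : ℝ in 𝓝 0, |u| < 1 / 2 := by
    have := Metric.ball_mem_nhds (0 : ℝ) (show (0 : ℝ) < 1 / 2 by norm_num)
    filter_upwards [this] with u hu
    simpa using hu
  filter_upwards [ht1.eventually_lt_const hδ, ht2.eventually_lt_const hδ,
    ht3.eventually_lt_const (show 0 < c - 1 by linarith), ht4] with u h1 h2 h3 h4
  have h5 : 1 - (u : ℂ) ^ 2 ≠ 0 := by
    refine one_sub_sq_ne_zero ?_
    rw [Complex.norm_real, Real.norm_eq_abs]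
    linarith
  rw [coshRho, ← tsum_family_taylor hF hc h3, ← h _ _ h1 h2, ← tsum_mul_left]
  refine tsum_congr fun n => ?_
  have e1 : 2 * (2 * (u : ℂ) ^ 2 / (1 - u ^ 2)) + (2 * (u : ℂ) ^ 2 / (1 - u ^ 2)) ^ 2 =
      (2 * (u : ℂ) / (1 - u ^ 2)) ^ 2 := by
    field_simp
    ring
  rw [e1, sum_gegenbauerTerm hμ, regHypSeries_radial_eq μ ν n h4, additionTerm, div_pow]
  field_simp

/-- The addition theorem for a family of functions on `Re z > 1` satisfying the relations of
`(z² - 1)^{-(μ + n)/2} P_ν^{μ + n}(z)`. -/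
theorem addition_theorem {μ : ℂ} (hμ : -(1 / 2 : ℝ) < μ.re) (hμ0 : μ ≠ 0) {ν : ℂ}
    (hF : ∀ n z, 1 < z.re → HasDerivAt (F n) (F (n + 1) z) z) {v c s : ℝ} (hv0 : 0 < v)
    (hv1 : v < 1) (hc : c = (1 + v ^ 2) / (1 - v ^ 2)) (hs : s = 2 * v / (1 - v ^ 2))
    (hode : ∀ n : ℕ, (s : ℂ) ^ 2 * F (n + 2) c + 2 * (μ + n + 1) * c * F (n + 1) c +
      legendreConst μ ν n * F n c = 0) (γ : ℝ) {u : ℝ} (hu : |u| < v) :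
    Summable (fun n => additionTerm μ ν s (fun n => F n c) (Real.cos γ) n u) ∧
    F 0 (coshRho c s (Real.cos γ) u) = (1 - (u : ℂ) ^ 2) ^ (μ - ν) *
      ∑' n, additionTerm μ ν s (fun n => F n c) (Real.cos γ) n u := by
  have h1v : 0 < 1 - v ^ 2 := by nlinarith
  have hc1 : 1 < c := by
    rw [hc, lt_div_iff₀ h1v]
    nlinarith
  -- This is sinh r' tanh(r'/2) = cosh r' - 1, which converts the Cauchy radius c - 1 into the bound
  -- |u| < v.
  have hsv : s * v = c - 1 := by
    rw [hc, hs]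
    field_simp
    ring
  constructor
  · obtain ⟨τ, huτ, hτv⟩ := exists_between hu
    obtain ⟨M, hM, hle⟩ := exists_summable_norm_additionTerm_le hμ hμ0 ν hF hv0 hv1 hc1 hsv γ
      ((abs_nonneg u).trans_lt huτ) hτv
    refine Summable.of_norm_bounded hM fun n => hle n u ?_
    rw [Complex.norm_real, Real.norm_eq_abs]
    exact huτ.le
  have hlt : ∀ x ∈ Set.Ioo (-v) v, |x| < v := fun x hx => abs_lt.mpr hx
  have hball : ∀ x ∈ Set.Ioo (-v) v, (x : ℂ) ∈ Metric.ball (0 : ℂ) v := fun x hx => by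
    rw [mem_ball_zero_iff, Complex.norm_real, Real.norm_eq_abs]
    exact hlt x hx
  have hne : ∀ x ∈ Set.Ioo (-v) v, 1 - (x : ℂ) ^ 2 ≠ 0 := fun x hx =>
    one_sub_sq_ne_zero ((mem_ball_zero_iff.mp (hball x hx)).trans hv1)
  have hL : AnalyticOnNhd ℝ (fun x : ℝ => F 0 (coshRho c s (Real.cos γ) x)) (Set.Ioo (-v) v) := by
    intro x hx
    refine analyticAt_comp_ofReal (g := fun w => F 0 (coshRho c s (Real.cos γ) w)) ?_
    have h1 : AnalyticAt ℂ (F 0) (coshRho c s (Real.cos γ) x) := by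
      refine (differentiableOn_family hF 0).analyticAt (isOpen_one_lt_re.mem_nhds ?_)
      rw [hc, hs]
      exact one_lt_coshRho hv1 (hlt x hx)
    refine h1.comp (f := fun w => coshRho c s (Real.cos γ) w) ?_
    have hx0 := hne x hx
    simp only [coshRho]
    fun_prop (disch := assumption)
  have hR : AnalyticOnNhd ℝ (fun x : ℝ => (1 - (x : ℂ) ^ 2) ^ (μ - ν) *
      ∑' n, additionTerm μ ν s (fun n => F n c) (Real.cos γ) n x) (Set.Ioo (-v) v) := by
    intro x hx
    refine analyticAt_comp_ofReal (g := fun w => (1 - w ^ 2) ^ (μ - ν) *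
      ∑' n, additionTerm μ ν s (fun n => F n c) (Real.cos γ) n w) ?_
    refine AnalyticAt.mul ?_ ((differentiableOn_tsum_additionTerm hμ hμ0 ν hF hv0 hv1 hc1 hsv
      γ).analyticAt (Metric.isOpen_ball.mem_nhds (hball x hx)))
    refine AnalyticAt.cpow (by fun_prop) (by fun_prop) (Or.inl ?_)
    have : (1 - (x : ℂ) ^ 2) = ((1 - x ^ 2 : ℝ) : ℂ) := by push_cast; ring
    rw [this, Complex.ofReal_re]
    have := sq_lt_one_iff_abs_lt_one x |>.mpr ((hlt x hx).trans hv1)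
    linarith
  -- The identity theorem is used for real-analytic functions on (-v, v), where `coshRho` is known
  -- to stay in Re z > 1.
  exact hL.eqOn_of_preconnected_of_eventuallyEq hR isPreconnected_Ioo (z₀ := 0)
    ⟨by linarith, hv0⟩ (addition_eventuallyEq hμ hμ0 hF hc1 hode _) (abs_lt.mp hu)

end Family

/-! ### Legendre functions of the first kind -/

theorem hypCoeff_sub_one (a b c : ℂ) (i : ℕ) :
    hypCoeff a b (c - 1) i = (c - 1 + i) * hypCoeff a b c i := by
  rw [hypCoeff, hypCoeff, inv_Gamma_eq_mul (c - 1 + i), show c - 1 + i + 1 = c + i by ring]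
  ring

theorem hasSum_hypCoeff_succ (a b c : ℂ) {w : ℂ} (hw : ‖w‖ < 1) :
    HasSum (fun i => hypCoeff a b c (i + 1) * w ^ (i + 1))
      (regHypSeries a b c w - hypCoeff a b c 0) := by
  have := (hasSum_nat_add_iff' 1).mpr (hasSum_regHypSeries a b c w hw)
  simpa using this

/-- Equivalently, w^(c-1) times the regularized series differentiates to w^(c-2) times the series
with c lowered by one. With c = 1 - M this becomes F_M' = F_{M+1}. -/
theorem regHypSeries_sub_one (a b c : ℂ) {w : ℂ} (hw : ‖w‖ < 1) :
    w * deriv (regHypSeries a b c) w + (c - 1) * regHypSeries a b c w =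
      regHypSeries a b (c - 1) w := by
  refine ((hasSum_mul_deriv_regHypSeries a b c hw).add
    ((hasSum_regHypSeries a b c w hw).mul_left (c - 1))).unique
    ((hasSum_regHypSeries a b (c - 1) w hw).congr_fun fun i => ?_)
  rw [hypCoeff_sub_one]
  ring

theorem regHypSeries_contiguous (ν c : ℂ) {w : ℂ} (hw : ‖w‖ < 1) :
    (1 - w) * regHypSeries (-ν) (ν + 1) (c - 1 - 1) w +
      (2 - c) * (1 - 2 * w) * regHypSeries (-ν) (ν + 1) (c - 1) w +
      (ν * (ν + 1) - (1 - c) * (2 - c)) * w * regHypSeries (-ν) (ν + 1) c w = 0 := by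
  have A2 := hasSum_hypCoeff_succ (-ν) (ν + 1) (c - 1 - 1) hw
  have B2 := hasSum_regHypSeries (-ν) (ν + 1) (c - 1 - 1) w hw
  have A1 := hasSum_hypCoeff_succ (-ν) (ν + 1) (c - 1) hw
  have B1 := hasSum_regHypSeries (-ν) (ν + 1) (c - 1) w hw
  have B0 := hasSum_regHypSeries (-ν) (ν + 1) c w hw
  -- Coefficients of w^(i+1) are compared, so unmultiplied series enter without their constant
  -- terms; these cancel separately at the end.
  have h := ((A2.sub (B2.mul_left w)).add ((A1.sub (B1.mul_left (2 * w))).mul_left (2 - c))).add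
    (B0.mul_left ((ν * (ν + 1) - (1 - c) * (2 - c)) * w))
  have h0 := h.unique ((hasSum_zero (α := ℂ) (β := ℕ)).congr_fun fun i => by
    have := hypCoeff_succ (-ν) (ν + 1) c i
    simp only [hypCoeff_sub_one]
    push_cast
    rw [pow_succ]
    linear_combination w ^ i * w * this)
  simp only [hypCoeff_sub_one] at h0
  push_cast at h0
  linear_combination h0

theorem eqOn_re_lt_half {f : ℂ → ℂ} (hf : DifferentiableOn ℂ f {w : ℂ | w.re < 1 / 2})
    (h0 : ∀ᶠ w in 𝓝 (0 : ℂ), f w = 0) {w : ℂ} (hw : w.re < 1 / 2) : f w = 0 :=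
  (hf.analyticOnNhd isOpen_re_lt_half).eqOn_zero_of_preconnected_of_eventuallyEq_zero
    convex_re_lt_half.isPreconnected (z₀ := 0) (by simp) h0 hw

theorem pfaffHyp_sub_one (a b c : ℂ) {w : ℂ} (hw : w.re < 1 / 2) :
    w * deriv (pfaffHyp a b c) w + (c - 1) * pfaffHyp a b c w = pfaffHyp a b (c - 1) w := by
  have hd := (differentiableOn_pfaffHyp a b c).deriv isOpen_re_lt_half
  refine sub_eq_zero.mp (eqOn_re_lt_half (f := fun w => w * deriv (pfaffHyp a b c) w +
    (c - 1) * pfaffHyp a b c w - pfaffHyp a b (c - 1) w) ?_ ?_ hw)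
  · exact ((differentiableOn_id.mul hd).add ((differentiableOn_pfaffHyp a b c).const_mul _)).sub
      (differentiableOn_pfaffHyp a b (c - 1))
  · filter_upwards [regHypSeries_eventuallyEq_pfaffHyp a b c,
      (regHypSeries_eventuallyEq_pfaffHyp a b c).deriv,
      regHypSeries_eventuallyEq_pfaffHyp a b (c - 1), Metric.ball_mem_nhds (0 : ℂ) one_pos]
      with w h1 h2 h3 h4
    rw [← h1, ← h2, ← h3, regHypSeries_sub_one a b c (mem_ball_zero_iff.mp h4), sub_self]

theorem pfaffHyp_contiguous (ν c : ℂ) {w : ℂ} (hw : w.re < 1 / 2) :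
    (1 - w) * pfaffHyp (-ν) (ν + 1) (c - 1 - 1) w +
      (2 - c) * (1 - 2 * w) * pfaffHyp (-ν) (ν + 1) (c - 1) w +
      (ν * (ν + 1) - (1 - c) * (2 - c)) * w * pfaffHyp (-ν) (ν + 1) c w = 0 := by
  refine eqOn_re_lt_half (f := fun w => (1 - w) * pfaffHyp (-ν) (ν + 1) (c - 1 - 1) w +
      (2 - c) * (1 - 2 * w) * pfaffHyp (-ν) (ν + 1) (c - 1) w +
      (ν * (ν + 1) - (1 - c) * (2 - c)) * w * pfaffHyp (-ν) (ν + 1) c w) ?_ ?_ hw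
  · have h0 := differentiableOn_pfaffHyp (-ν) (ν + 1) c
    have h1 := differentiableOn_pfaffHyp (-ν) (ν + 1) (c - 1)
    have h2 := differentiableOn_pfaffHyp (-ν) (ν + 1) (c - 1 - 1)
    fun_prop
  · filter_upwards [regHypSeries_eventuallyEq_pfaffHyp (-ν) (ν + 1) c,
      regHypSeries_eventuallyEq_pfaffHyp (-ν) (ν + 1) (c - 1),
      regHypSeries_eventuallyEq_pfaffHyp (-ν) (ν + 1) (c - 1 - 1),
      Metric.ball_mem_nhds (0 : ℂ) one_pos] with w h1 h2 h3 h4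
    rw [← h1, ← h2, ← h3]
    exact regHypSeries_contiguous ν c (mem_ball_zero_iff.mp h4)

/-- The function `(z² - 1)^{-M/2} P_ν^M(z)` on the half-plane `Re z > 1`. -/
noncomputable def reducedP (ν M z : ℂ) : ℂ :=
  (z - 1) ^ (-M) * pfaffHyp (-ν) (ν + 1) (1 - M) ((1 - z) / 2)

theorem sub_one_mem_slitPlane {z : ℂ} (hz : 1 < z.re) : z - 1 ∈ Complex.slitPlane :=
  Or.inl (by simp; linarith)

theorem re_half_one_sub_lt {z : ℂ} (hz : 1 < z.re) : ((1 - z) / 2).re < 1 / 2 := by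
  simp
  linarith

theorem hasDerivAt_reducedP (ν M : ℂ) {z : ℂ} (hz : 1 < z.re) :
    HasDerivAt (reducedP ν M) (reducedP ν (M + 1) z) z := by
  have hw := re_half_one_sub_lt hz
  have hne : z - 1 ≠ 0 := Complex.slitPlane_ne_zero (sub_one_mem_slitPlane hz)
  have h1 : HasDerivAt (fun z : ℂ => (z - 1) ^ (-M)) (-M * (z - 1) ^ (-M - 1) * 1) z :=
    ((hasDerivAt_id z).sub_const 1).cpow_const (sub_one_mem_slitPlane hz)
  have h2 : HasDerivAt (fun z : ℂ => (1 - z) / 2) (-1 / 2) z :=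
    ((hasDerivAt_id z).const_sub 1).div_const 2
  have h3 := (((differentiableOn_pfaffHyp (-ν) (ν + 1) (1 - M)).differentiableAt
    (isOpen_re_lt_half.mem_nhds hw)).hasDerivAt).comp z h2
  refine (h1.mul h3).congr_deriv ?_
  have h4 := pfaffHyp_sub_one (-ν) (ν + 1) (1 - M) hw
  rw [reducedP, show 1 - (M + 1) = 1 - M - 1 by ring, ← h4, show -(M + 1) = -M - 1 by ring,
    Complex.cpow_sub _ _ hne, Complex.cpow_one]
  simp only [Function.comp]
  field_simp
  ring

theorem reducedP_recurrence (ν M : ℂ) {z : ℂ} (hz : 1 < z.re) :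
    (z ^ 2 - 1) * reducedP ν (M + 2) z + 2 * (M + 1) * z * reducedP ν (M + 1) z +
      (M * (M + 1) - ν * (ν + 1)) * reducedP ν M z = 0 := by
  have hw := re_half_one_sub_lt hz
  have hne : z - 1 ≠ 0 := Complex.slitPlane_ne_zero (sub_one_mem_slitPlane hz)
  have h := pfaffHyp_contiguous ν (1 - M) hw
  simp only [reducedP]
  rw [show 1 - (M + 1) = 1 - M - 1 by ring, show 1 - (M + 2) = 1 - M - 1 - 1 by ring,
    show -(M + 1) = -M - 1 by ring, show -(M + 2) = -M - 2 by ring, Complex.cpow_sub _ _ hne,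
    Complex.cpow_sub _ _ hne, Complex.cpow_one, Complex.cpow_ofNat]
  field_simp
  linear_combination 2 * (z - 1) * (z - 1) ^ (-M) * h

/-- All bases are positive, so principal logarithms are real and 2 log s = log p + log m. It
rewrites the prefactor of P as sinh^M r (cosh r - 1)^(-M). -/
theorem cpow_half_div {p m s : ℝ} (hp : 0 < p) (hm : 0 < m) (hs : 0 < s) (h : s ^ 2 = p * m)
    (M : ℂ) : ((p / m : ℝ) : ℂ) ^ (M / 2) = (s : ℂ) ^ M * (m : ℂ) ^ (-M) := by
  have hl : 2 * Real.log s = Real.log p + Real.log m := by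
    rw [← Real.log_mul hp.ne' hm.ne', ← h, Real.log_pow]
    norm_num
  have hlc : 2 * (Real.log s : ℂ) = Real.log p + Real.log m := by exact_mod_cast hl
  rw [Complex.cpow_def_of_ne_zero (by exact_mod_cast (div_pos hp hm).ne'),
    Complex.cpow_def_of_ne_zero (by exact_mod_cast hs.ne'),
    Complex.cpow_def_of_ne_zero (by exact_mod_cast hm.ne'), ← Complex.ofReal_log (by positivity),
    ← Complex.ofReal_log hs.le, ← Complex.ofReal_log hm.le, Real.log_div hp.ne' hm.ne',
    ← Complex.exp_add]
  congr 1
  push_cast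
  linear_combination -(M / 2) * hlc

theorem one_lt_cosh_of_pos {r : ℝ} (hr : 0 < r) : 1 < Real.cosh r :=
  Real.one_lt_cosh.mpr hr.ne'

theorem legendreP_cosh (ν M : ℂ) {r : ℝ} (hr : 0 < r) :
    legendreP ν M (Real.cosh r) = (Real.sinh r : ℂ) ^ M * reducedP ν M (Real.cosh r : ℂ) := by
  have h1 := one_lt_cosh_of_pos hr
  rw [legendreP, regHyp_eq_pfaffHyp, cpow_half_div (s := Real.sinh r) (by linarith) (by linarith)
    (Real.sinh_pos_iff.mpr hr), reducedP]
  · push_cast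
    ring
  · rw [Real.sinh_sq]
    ring
  · rw [Complex.ofReal_re]
    linarith

/-! ### Legendre functions of the second kind -/

section SecondKind

/-- The hypergeometric function in the definition of `Q_ν^M`, with `a = ν + M + 1`. -/
noncomputable def hypQ (ν a w : ℂ) : ℂ := regHypSeries (a / 2) ((a + 1) / 2) (ν + 3 / 2) w

/-- Raising a by one replaces the pair (a/2, (a+1)/2) by ((a+1)/2, a/2 + 1), so only one rising
factorial changes. -/
theorem mul_hypCoeff_add_one (ν a : ℂ) (i : ℕ) :
    a * hypCoeff ((a + 1) / 2) ((a + 1 + 1) / 2) (ν + 3 / 2) i =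
      (a + 2 * i) * hypCoeff (a / 2) ((a + 1) / 2) (ν + 3 / 2) i := by
  have h := mul_poch_add_one (a / 2) i
  rw [hypCoeff, hypCoeff, show (a + 1 + 1) / 2 = a / 2 + 1 by ring]
  linear_combination 2 * poch ((a + 1) / 2) i * (Complex.Gamma (ν + 3 / 2 + i))⁻¹ /
    (i.factorial : ℂ) * h

theorem hypQ_add_one (ν a : ℂ) {w : ℂ} (hw : ‖w‖ < 1) :
    2 * (w * deriv (hypQ ν a) w) + a * hypQ ν a w = a * hypQ ν (a + 1) w := by
  refine (((hasSum_mul_deriv_regHypSeries (a / 2) ((a + 1) / 2) (ν + 3 / 2) hw).mul_left 2).add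
    ((hasSum_regHypSeries (a / 2) ((a + 1) / 2) (ν + 3 / 2) w hw).mul_left a)).unique
    (((hasSum_regHypSeries ((a + 1) / 2) ((a + 1 + 1) / 2) (ν + 3 / 2) w hw).mul_left
      a).congr_fun fun i => ?_)
  linear_combination -w ^ i * mul_hypCoeff_add_one ν a i

theorem hypQ_contiguous (ν a : ℂ) {w : ℂ} (hw : ‖w‖ < 1) :
    a * (a + 1) * (1 - w) * hypQ ν (a + 1 + 1) w - 2 * (a - ν) * (a * hypQ ν (a + 1) w) +
      a * (a - 2 * ν - 1) * hypQ ν a w = 0 := by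
  have A2 := hasSum_hypCoeff_succ ((a + 1 + 1) / 2) ((a + 1 + 1 + 1) / 2) (ν + 3 / 2) hw
  have B2 := hasSum_regHypSeries ((a + 1 + 1) / 2) ((a + 1 + 1 + 1) / 2) (ν + 3 / 2) w hw
  have A1 := hasSum_hypCoeff_succ ((a + 1) / 2) ((a + 1 + 1) / 2) (ν + 3 / 2) hw
  have A0 := hasSum_hypCoeff_succ (a / 2) ((a + 1) / 2) (ν + 3 / 2) hw
  have h := (((A2.sub (B2.mul_left w)).mul_left (a * (a + 1))).sub
    ((A1.mul_left a).mul_left (2 * (a - ν)))).add (A0.mul_left (a * (a - 2 * ν - 1)))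
  have h0 := h.unique ((hasSum_zero (α := ℂ) (β := ℕ)).congr_fun fun i => by
    have r1 := mul_hypCoeff_add_one ν a i
    have r1' := mul_hypCoeff_add_one ν a (i + 1)
    have r2 := mul_hypCoeff_add_one ν (a + 1) i
    have r2' := mul_hypCoeff_add_one ν (a + 1) (i + 1)
    have rs := hypCoeff_succ (a / 2) ((a + 1) / 2) (ν + 3 / 2) i
    push_cast at r1' r2'
    rw [pow_succ]
    linear_combination w ^ i * w * (a * r2' - a * r2 + (a + 1 + 2 * (i + 1)) * r1' -
      (a + 1 + 2 * i) * r1 - 2 * (a - ν) * r1' + 4 * rs))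
  have r1 := mul_hypCoeff_add_one ν a 0
  have r2 := mul_hypCoeff_add_one ν (a + 1) 0
  push_cast at r1 r2
  simp only [hypQ]
  linear_combination h0 + a * r2 + (a + 1) * r1 - 2 * (a - ν) * r1

/-- The function `(z² - 1)^{-M/2} Q_ν^M(z)` on the half-plane `Re z > 1`. -/
noncomputable def reducedQ (ν M z : ℂ) : ℂ :=
  (Real.sqrt Real.pi : ℂ) * Complex.exp (Complex.I * Real.pi * M) * Complex.Gamma (ν + M + 1) /
    (2 : ℂ) ^ (ν + 1) * (z ^ (-(ν + M + 1)) * hypQ ν (ν + M + 1) (z ^ 2)⁻¹)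

theorem norm_inv_sq_lt_one {z : ℂ} (hz : 1 < z.re) : ‖(z ^ 2)⁻¹‖ < 1 := by
  have h := hz.trans_le (Complex.re_le_norm z)
  rw [norm_inv, norm_pow]
  exact inv_lt_one_of_one_lt₀ (one_lt_pow₀ h two_ne_zero)

theorem exp_I_pi_add_one (M : ℂ) :
    Complex.exp (Complex.I * Real.pi * (M + 1)) = -Complex.exp (Complex.I * Real.pi * M) := by
  rw [mul_add, mul_one, Complex.exp_add, mul_comm Complex.I, Complex.exp_pi_mul_I]
  ring

/-- The factor a of Γ(a+1) = aΓ(a), with a = ν + M + 1 ≠ 0, matches the one in `hypQ_add_one`; the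
sign from differentiating z^(-a) is supplied by e^{iπ} = -1. -/
theorem hasDerivAt_reducedQ {ν M : ℂ} (hM : ν + M + 1 ≠ 0) {z : ℂ} (hz : 1 < z.re) :
    HasDerivAt (reducedQ ν M) (reducedQ ν (M + 1) z) z := by
  have hw := norm_inv_sq_lt_one hz
  have hne : z ≠ 0 := by
    rintro rfl
    simp at hz
    linarith
  set a := ν + M + 1 with ha
  have h1 : HasDerivAt (fun z : ℂ => z ^ (-a)) (-a * z ^ (-a - 1) * 1) z :=
    (hasDerivAt_id z).cpow_const (Or.inl (by simp; linarith))
  have h2 : HasDerivAt (fun z : ℂ => (z ^ 2)⁻¹) (-(2 * z) / (z ^ 2) ^ 2) z := by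
    have := (hasDerivAt_pow 2 z).fun_inv (pow_ne_zero 2 hne)
    simpa using this
  have h3 := (((differentiableOn_regHypSeries (a / 2) ((a + 1) / 2) (ν + 3 / 2)).differentiableAt
    (Metric.isOpen_ball.mem_nhds (mem_ball_zero_iff.mpr hw))).hasDerivAt).comp z h2
  refine ((h1.mul h3).const_mul _).congr_deriv ?_
  have h4 := hypQ_add_one ν a hw
  have hG : Complex.Gamma (ν + (M + 1) + 1) = a * Complex.Gamma a := by
    rw [← Complex.Gamma_add_one a hM]
    congr 1
    rw [ha]
    ring
  have h5 : -(ν + (M + 1) + 1) = -a - 1 := by rw [ha]; ring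
  have h6 : ν + (M + 1) + 1 = a + 1 := by rw [ha]; ring
  have h7 : deriv (regHypSeries (a / 2) ((a + 1) / 2) (ν + 3 / 2)) (z ^ 2)⁻¹ =
    deriv (hypQ ν a) (z ^ 2)⁻¹ := rfl
  rw [reducedQ, hG, exp_I_pi_add_one, h5, h6, h7]
  simp only [Function.comp]
  change _ * (_ * hypQ ν a (z ^ 2)⁻¹ + _) = _
  rw [Complex.cpow_sub _ _ hne, Complex.cpow_one]
  have h8 : a * hypQ ν (a + 1) (z ^ 2)⁻¹ =
    2 * ((z ^ 2)⁻¹ * deriv (hypQ ν a) (z ^ 2)⁻¹) + a * hypQ ν a (z ^ 2)⁻¹ := h4.symm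
  have h9 : (2 : ℂ) ^ (ν + 1) ≠ 0 := by simp [Complex.cpow_eq_zero_iff]
  generalize hypQ ν (a + 1) (z ^ 2)⁻¹ = T1 at *
  generalize deriv (hypQ ν a) (z ^ 2)⁻¹ = T' at *
  generalize hypQ ν a (z ^ 2)⁻¹ = T0 at *
  generalize z ^ (-a) = Z at *
  generalize (2 : ℂ) ^ (ν + 1) = W at *
  have h8' : a * T1 * z ^ 2 = 2 * T' + a * T0 * z ^ 2 := by
    rw [h8]
    field_simp
  field_simp
  linear_combination Complex.Gamma a * Z * h8'

theorem reducedQ_recurrence {ν M : ℂ} (hM : ν + M + 1 ≠ 0) (hM' : ν + M + 1 + 1 ≠ 0) {z : ℂ}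
    (hz : 1 < z.re) :
    (z ^ 2 - 1) * reducedQ ν (M + 2) z + 2 * (M + 1) * z * reducedQ ν (M + 1) z +
      (M * (M + 1) - ν * (ν + 1)) * reducedQ ν M z = 0 := by
  have hw := norm_inv_sq_lt_one hz
  have hne : z ≠ 0 := by
    rintro rfl
    simp at hz
    linarith
  have h := hypQ_contiguous ν (ν + M + 1) hw
  have hG1 : Complex.Gamma (ν + (M + 1) + 1) = (ν + M + 1) * Complex.Gamma (ν + M + 1) := by
    rw [← Complex.Gamma_add_one _ hM]
    congr 1
    ring
  have hG2 : Complex.Gamma (ν + (M + 2) + 1) =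
      (ν + M + 1 + 1) * ((ν + M + 1) * Complex.Gamma (ν + M + 1)) := by
    rw [← Complex.Gamma_add_one _ hM, ← Complex.Gamma_add_one _ hM']
    congr 1
    ring
  have hE : Complex.exp (Complex.I * Real.pi * (M + 2)) =
      Complex.exp (Complex.I * Real.pi * M) := by
    rw [show M + 2 = M + 1 + 1 by ring, exp_I_pi_add_one, exp_I_pi_add_one, neg_neg]
  have h9 : (2 : ℂ) ^ (ν + 1) ≠ 0 := by simp [Complex.cpow_eq_zero_iff]
  simp only [reducedQ]
  rw [hG1, hG2, hE, exp_I_pi_add_one, show -(ν + (M + 1) + 1) = -(ν + M + 1) - 1 by ring,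
    show -(ν + (M + 2) + 1) = -(ν + M + 1) - 2 by ring,
    show ν + (M + 1) + 1 = ν + M + 1 + 1 by ring, show ν + (M + 2) + 1 = ν + M + 1 + 1 + 1 by ring,
    Complex.cpow_sub _ _ hne, Complex.cpow_sub _ _ hne, Complex.cpow_one, Complex.cpow_ofNat]
  generalize hypQ ν (ν + M + 1 + 1 + 1) (z ^ 2)⁻¹ = T2 at *
  generalize hypQ ν (ν + M + 1 + 1) (z ^ 2)⁻¹ = T1 at *
  generalize hypQ ν (ν + M + 1) (z ^ 2)⁻¹ = T0 at *
  generalize z ^ (-(ν + M + 1)) = Z at *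
  generalize (2 : ℂ) ^ (ν + 1) = W at *
  have h' : (ν + M + 1) * (ν + M + 1 + 1) * (z ^ 2 - 1) * T2 -
      2 * (ν + M + 1 - ν) * ((ν + M + 1) * T1) * z ^ 2 +
      (ν + M + 1) * (ν + M + 1 - 2 * ν - 1) * T0 * z ^ 2 = 0 := by
    have := congrArg (· * z ^ 2) h
    simp only [zero_mul] at this
    rw [← this]
    field_simp
  field_simp
  linear_combination (Real.sqrt Real.pi : ℂ) * Complex.exp (Complex.I * Real.pi * M) *
    Complex.Gamma (ν + M + 1) * Z * h'

theorem legendreQ_cosh (ν M : ℂ) {r : ℝ} (hr : 0 < r) :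
    legendreQ ν M (Real.cosh r) = (Real.sinh r : ℂ) ^ M * reducedQ ν M (Real.cosh r : ℂ) := by
  have h1 := one_lt_cosh_of_pos hr
  have hs := Real.sinh_pos_iff.mpr hr
  have hz : 1 < ((Real.cosh r : ℝ) : ℂ).re := by rwa [Complex.ofReal_re]
  have e : ((1 / Real.cosh r ^ 2 : ℝ) : ℂ) = ((Real.cosh r : ℂ) ^ 2)⁻¹ := by push_cast; simp
  have hw := norm_inv_sq_lt_one hz
  have h2 : ((Real.cosh r ^ 2 - 1 : ℝ) : ℂ) ^ (M / 2) = (Real.sinh r : ℂ) ^ M := by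
    have := cpow_half_div (p := Real.sinh r ^ 2) (m := 1) (s := Real.sinh r) (by positivity)
      one_pos hs (by ring) M
    rw [div_one] at this
    rw [← Real.sinh_sq, this]
    simp
  rw [legendreQ, e, regHyp, if_pos hw, h2, reducedQ, hypQ,
    show (ν + M + 1 + 1) / 2 = (ν + M + 2) / 2 by ring, Complex.cpow_neg]
  ring

end SecondKind

/-! ### Half-angle coordinates and assembly of the theorem -/

theorem cosh_eq_tanh_half (r : ℝ) :
    Real.cosh r = (1 + Real.tanh (r / 2) ^ 2) / (1 - Real.tanh (r / 2) ^ 2) := by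
  have h0 := (Real.cosh_pos (r / 2)).ne'
  have h1 := Real.cosh_sq_sub_sinh_sq (r / 2)
  have h2 : 1 - Real.tanh (r / 2) ^ 2 = 1 / Real.cosh (r / 2) ^ 2 := by
    rw [Real.tanh_eq_sinh_div_cosh]
    field_simp
    exact h1
  have h3 : Real.cosh r = Real.cosh (r / 2) ^ 2 + Real.sinh (r / 2) ^ 2 := by
    rw [← Real.cosh_two_mul]
    congr 1
    ring
  rw [h2, h3, Real.tanh_eq_sinh_div_cosh]
  field_simp

theorem sinh_eq_tanh_half (r : ℝ) :
    Real.sinh r = 2 * Real.tanh (r / 2) / (1 - Real.tanh (r / 2) ^ 2) := by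
  have h0 := (Real.cosh_pos (r / 2)).ne'
  have h1 := Real.cosh_sq_sub_sinh_sq (r / 2)
  have h2 : 1 - Real.tanh (r / 2) ^ 2 = 1 / Real.cosh (r / 2) ^ 2 := by
    rw [Real.tanh_eq_sinh_div_cosh]
    field_simp
    exact h1
  have h3 : Real.sinh r = 2 * Real.sinh (r / 2) * Real.cosh (r / 2) := by
    rw [← Real.sinh_two_mul]
    congr 1
    ring
  rw [h2, h3, Real.tanh_eq_sinh_div_cosh]
  field_simp

theorem tanh_half_pos {r : ℝ} (hr : 0 < r) : 0 < Real.tanh (r / 2) := by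
  rw [Real.tanh_eq_sinh_div_cosh]
  exact div_pos (Real.sinh_pos_iff.mpr (by linarith)) (Real.cosh_pos _)

/-- For w = (1 - cosh r)/2 = -u²/(1-u²) one has w/(w-1) = u², so Pfaff's form is exactly the radial
factor of `additionTerm`. -/
theorem legendreP_neg_cosh (ν M : ℂ) {r u : ℝ} (hr : 0 < r) (hu : u = Real.tanh (r / 2)) :
    legendreP ν (-M) (Real.cosh r) = (u : ℂ) ^ M * (1 - (u : ℂ) ^ 2) ^ (-ν) *
      regHypSeries (M - ν) (-ν) (1 + M) ((u : ℂ) ^ 2) := by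
  have hu0 : 0 < u := hu ▸ tanh_half_pos hr
  have hu1 : u < 1 := hu ▸ Real.tanh_lt_one _
  have h1 : 0 < 1 - u ^ 2 := by nlinarith
  have hc := cosh_eq_tanh_half r
  rw [← hu] at hc
  have h1c : (1 - (u : ℂ) ^ 2) = ((1 - u ^ 2 : ℝ) : ℂ) := by push_cast; ring
  have h1n : ((1 - u ^ 2 : ℝ) : ℂ) ≠ 0 := by exact_mod_cast h1.ne'
  have hcp := one_lt_cosh_of_pos hr
  have e1 : (Real.cosh r + 1) / (Real.cosh r - 1) = (1 : ℝ) / u ^ 2 := by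
    have a1 : Real.cosh r + 1 = 2 / (1 - u ^ 2) := by rw [hc]; field_simp; ring
    have a2 : Real.cosh r - 1 = 2 * u ^ 2 / (1 - u ^ 2) := by rw [hc]; field_simp; ring
    rw [a1, a2]
    field_simp
  have e2 : (((1 - Real.cosh r) / 2 : ℝ) : ℂ) = ((-(u ^ 2 / (1 - u ^ 2)) : ℝ) : ℂ) := by
    congr 1
    rw [hc]
    field_simp
    ring
  have e3 : 1 - ((-(u ^ 2 / (1 - u ^ 2)) : ℝ) : ℂ) = ((1 - u ^ 2 : ℝ) : ℂ)⁻¹ := by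
    rw [← Complex.ofReal_inv, ← Complex.ofReal_one, ← Complex.ofReal_sub]
    congr 1
    field_simp
    ring
  have e4 : ((-(u ^ 2 / (1 - u ^ 2)) : ℝ) : ℂ) / (((-(u ^ 2 / (1 - u ^ 2)) : ℝ) : ℂ) - 1) =
      (u : ℂ) ^ 2 := by
    rw [← neg_sub 1, e3, Complex.ofReal_neg, neg_div_neg_eq, Complex.ofReal_div, div_inv_eq_mul,
      div_mul_cancel₀ _ h1n, Complex.ofReal_pow]
  rw [legendreP, regHyp_eq_pfaffHyp, pfaffHyp, e1, e2, e3, e4]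
  · have p1 : ((1 / u ^ 2 : ℝ) : ℂ) ^ (-M / 2) = (u : ℂ) ^ M := by
      have h := cpow_half_div (p := u ^ 2) (m := 1) (s := u) (by positivity) one_pos hu0 (by ring) M
      rw [div_one, Complex.ofReal_one, Complex.one_cpow, mul_one] at h
      rw [one_div, Complex.ofReal_inv, Complex.inv_cpow, neg_div, Complex.cpow_neg, inv_inv, h]
      rw [Complex.arg_ofReal_of_nonneg (by positivity)]
      exact Real.pi_pos.ne
    have p2 : (((1 - u ^ 2 : ℝ) : ℂ)⁻¹) ^ (-(-ν)) = (1 - (u : ℂ) ^ 2) ^ (-ν) := by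
      rw [Complex.inv_cpow, ← Complex.cpow_neg, neg_neg, h1c]
      rw [Complex.arg_ofReal_of_nonneg h1.le]
      exact Real.pi_pos.ne
    rw [p1, p2, regHypSeries_eq_tsum, regHypSeries_eq_tsum (M - ν), mul_assoc]
    congr 2
    refine tsum_congr fun i => ?_
    rw [hypCoeff_symm, show 1 - -M - (ν + 1) = M - ν by ring, show 1 - -M = 1 + M by ring]
  · rw [Complex.ofReal_re]
    linarith

theorem Gamma_one_add_eq {μ : ℂ} (hμ : -(1 / 2 : ℝ) < μ.re) (hμ0 : μ ≠ 0) (n : ℕ) :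
    Complex.Gamma (1 + μ + n) = (n + μ) * poch μ n * Complex.Gamma μ := by
  have hn := add_natCast_ne_zero hμ hμ0
  have hG : ∀ n : ℕ, Complex.Gamma (μ + n) ≠ 0 := fun n => Complex.Gamma_ne_zero fun m h =>
    hn (n + m) (by push_cast; linear_combination h)
  have h1 := poch_mul_inv_Gamma μ n
  rw [show 1 + μ + n = μ + n + 1 by ring, Complex.Gamma_add_one _ (hn n)]
  have h2 : Complex.Gamma (μ + n) = poch μ n * Complex.Gamma μ := by
    have h3 := hG n
    have h4 : Complex.Gamma μ ≠ 0 := by simpa using hG 0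
    field_simp at h1
    rw [h1]
  rw [h2]
  ring

/-- The addition theorem in hyperbolic coordinates, for a family of functions on `Re z > 1` that
satisfies the relations of `(z² - 1)^{-(μ + n)/2} P_ν^{μ + n}(z)`. -/
theorem hyperbolic_addition_theorem {μ ν : ℂ} (hμ : -(1 / 2 : ℝ) < μ.re) (hμ0 : μ ≠ 0)
    {F : ℕ → ℂ → ℂ} (hF : ∀ n z, 1 < z.re → HasDerivAt (F n) (F (n + 1) z) z)
    (hode : ∀ (n : ℕ) (z : ℂ), 1 < z.re → (z ^ 2 - 1) * F (n + 2) z +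
      2 * (μ + n + 1) * z * F (n + 1) z + legendreConst μ ν n * F n z = 0)
    {L : ℕ → ℝ → ℂ}
    (hL : ∀ (n : ℕ) (r : ℝ), 0 < r →
      L n (Real.cosh r) = (Real.sinh r : ℂ) ^ (μ + n) * F n (Real.cosh r : ℂ))
    {r r' γ ρ : ℝ} (hr : 0 < r) (hrr' : r < r') (hρ : 0 ≤ ρ)
    (hcosh : Real.cosh ρ =
      Real.cosh r * Real.cosh r' - Real.sinh r * Real.sinh r' * Real.cos γ) :
    Summable (fun n : ℕ => (-1 : ℂ) ^ n * (n + μ) * legendreP ν (-(μ + n)) (Real.cosh r) *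
        L n (Real.cosh r') * gegenbauerC n μ (Real.cos γ)) ∧
      1 / (Real.sinh ρ : ℂ) ^ μ * L 0 (Real.cosh ρ) =
        (2 : ℂ) ^ μ * Complex.Gamma μ / ((Real.sinh r * Real.sinh r' : ℝ) : ℂ) ^ μ *
          ∑' n : ℕ, (-1 : ℂ) ^ n * (n + μ) * legendreP ν (-(μ + n)) (Real.cosh r) *
            L n (Real.cosh r') * gegenbauerC n μ (Real.cos γ) := by
  have hr' : 0 < r' := hr.trans hrr'
  set u := Real.tanh (r / 2) with hu
  set v := Real.tanh (r' / 2) with hv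
  have hu0 : 0 < u := tanh_half_pos hr
  have hv0 : 0 < v := tanh_half_pos hr'
  have hv1 : v < 1 := Real.tanh_lt_one _
  have huv : u < v := by
    rw [hu, hv, Real.tanh_eq_sinh_div_cosh, Real.tanh_eq_sinh_div_cosh,
      div_lt_div_iff₀ (Real.cosh_pos _) (Real.cosh_pos _)]
    have := Real.sinh_pos_iff.mpr (show 0 < r' / 2 - r / 2 by linarith)
    rw [Real.sinh_sub] at this
    linarith
  have h1u : 0 < 1 - u ^ 2 := by nlinarith
  have hc : Real.cosh r' = (1 + v ^ 2) / (1 - v ^ 2) := cosh_eq_tanh_half r'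
  have hs : Real.sinh r' = 2 * v / (1 - v ^ 2) := sinh_eq_tanh_half r'
  have hcr : Real.cosh r = (1 + u ^ 2) / (1 - u ^ 2) := cosh_eq_tanh_half r
  have hsr : Real.sinh r = 2 * u / (1 - u ^ 2) := sinh_eq_tanh_half r
  have hs0 := Real.sinh_pos_iff.mpr hr'
  have hsr0 := Real.sinh_pos_iff.mpr hr
  obtain ⟨hsum, heq⟩ := addition_theorem hμ hμ0 (ν := ν) hF hv0 hv1 hc hs (fun n => by
    have := hode n (Real.cosh r' : ℂ) (by
      rw [Complex.ofReal_re]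
      exact one_lt_cosh_of_pos hr')
    have h2 : (Real.cosh r' : ℂ) ^ 2 - 1 = (Real.sinh r' : ℂ) ^ 2 := by
      have := Real.cosh_sq' r'
      have h3 : (Real.cosh r' : ℂ) ^ 2 = 1 + (Real.sinh r' : ℂ) ^ 2 := by exact_mod_cast this
      rw [h3]
      ring
    rwa [h2] at this) γ (u := u) (by rwa [abs_of_pos hu0])
  have hG : Complex.Gamma μ ≠ 0 := Complex.Gamma_ne_zero fun m h =>
    add_natCast_ne_zero hμ hμ0 m (by rw [h]; ring)
  have hz : coshRho (Real.cosh r') (Real.sinh r') (Real.cos γ) u = (Real.cosh ρ : ℂ) := by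
    have e : Real.cosh ρ = Real.cosh r' + (Real.cosh r' * (2 * u ^ 2 / (1 - u ^ 2)) -
        Real.sinh r' * (2 * u / (1 - u ^ 2) * Real.cos γ)) := by
      rw [hcosh, hcr, hsr]
      field_simp
      ring
    rw [e, coshRho]
    push_cast
    ring
  -- Since r ≠ r' forces cosh ρ > 1, the case ρ = 0 is excluded and sinh ρ can be divided by.
  have hρ0 : 0 < ρ := by
    rcases hρ.eq_or_lt with h | h
    · exfalso
      have h3 := one_lt_coshRho (γ := γ) hv1 (by rwa [abs_of_pos hu0] : |u| < v)
      rw [← hc, ← hs, hz, ← h, Complex.ofReal_re, Real.cosh_zero] at h3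
      exact lt_irrefl _ h3
    · exact h
  have h1c : (1 - (u : ℂ) ^ 2) = ((1 - u ^ 2 : ℝ) : ℂ) := by push_cast; ring
  have h1n : (1 - (u : ℂ) ^ 2) ≠ 0 := by
    rw [h1c]
    exact_mod_cast h1u.ne'
  have hun : (u : ℂ) ≠ 0 := by exact_mod_cast hu0.ne'
  have hsn : (Real.sinh r' : ℂ) ≠ 0 := by exact_mod_cast hs0.ne'
  have hpow : (Real.sinh r : ℂ) ^ μ * (1 - (u : ℂ) ^ 2) ^ μ = 2 ^ μ * (u : ℂ) ^ μ := by
    rw [h1c, ← Complex.mul_cpow_ofReal_nonneg hsr0.le h1u.le, ← Complex.ofReal_mul,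
      show Real.sinh r * (1 - u ^ 2) = 2 * u by rw [hsr]; field_simp, Complex.ofReal_mul,
      Complex.mul_cpow_ofReal_nonneg (by norm_num) hu0.le]
    norm_num
  have h2n : (2 : ℂ) ^ μ ≠ 0 := by simp [Complex.cpow_eq_zero_iff]
  have hsrn : (Real.sinh r : ℂ) ^ μ ≠ 0 := by
    rw [Ne, Complex.cpow_eq_zero_iff]
    exact fun h => hsr0.ne' (by exact_mod_cast h.1)
  have hsn' : (Real.sinh r' : ℂ) ^ μ ≠ 0 := by
    rw [Ne, Complex.cpow_eq_zero_iff]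
    exact fun h => hsn h.1
  have hρn : (Real.sinh ρ : ℂ) ^ μ ≠ 0 := by
    rw [Ne, Complex.cpow_eq_zero_iff]
    exact fun h => (Real.sinh_pos_iff.mpr hρ0).ne' (by exact_mod_cast h.1)
  have hmul : ((Real.sinh r * Real.sinh r' : ℝ) : ℂ) ^ μ =
      (Real.sinh r : ℂ) ^ μ * (Real.sinh r' : ℂ) ^ μ := by
    rw [Complex.ofReal_mul, Complex.mul_cpow_ofReal_nonneg hsr0.le hs0.le]
  -- Γ(1+μ+n) = (n+μ)(μ)_n Γ(μ) produces the weight n + μ and cancels the (μ)_n of `additionCoeff`;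
  -- all remaining factors are independent of n.
  have hterm : ∀ n : ℕ, (-1 : ℂ) ^ n * (n + μ) * legendreP ν (-(μ + n)) (Real.cosh r) *
      L n (Real.cosh r') * gegenbauerC n μ (Real.cos γ) =
      (Real.sinh r : ℂ) ^ μ * (Real.sinh r' : ℂ) ^ μ / (2 ^ μ * Complex.Gamma μ) *
        (1 - (u : ℂ) ^ 2) ^ (μ - ν) *
        additionTerm μ ν (Real.sinh r') (fun n => F n (Real.cosh r')) (Real.cos γ) n u := by
    intro n
    have hp := poch_ne_zero (add_natCast_ne_zero hμ hμ0) n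
    rw [legendreP_neg_cosh ν (μ + n) hr hu, hL n r' hr', additionTerm, additionCoeff,
      Gamma_one_add_eq hμ hμ0, Complex.cpow_add _ _ hun, Complex.cpow_add _ _ hsn,
      Complex.cpow_natCast, Complex.cpow_natCast, sub_eq_add_neg μ ν, Complex.cpow_add _ _ h1n,
      ← add_assoc, neg_pow (Real.sinh r' : ℂ), mul_pow]
    have e1 : (u : ℂ) ^ μ = (Real.sinh r : ℂ) ^ μ * (1 - (u : ℂ) ^ 2) ^ μ / 2 ^ μ := by
      rw [hpow]
      field_simp
    rw [e1]
    field_simp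
  constructor
  · simp only [hterm]
    exact hsum.mul_left _
  · simp only [hterm]
    rw [tsum_mul_left, hL 0 ρ hρ0, hmul, ← hz]
    simp only [Nat.cast_zero, add_zero]
    rw [heq]
    field_simp

theorem mainTheorem2 (μ ν : ℂ) (hμ : -(1 / 2 : ℝ) < μ.re) (hμ0 : μ ≠ 0)
    (hν : ∀ k : ℕ, 1 ≤ k → ν ≠ -(k : ℂ))
    (r r' γ ρ : ℝ) (hr : 0 < r) (hr' : 0 < r') (hrr' : r ≠ r') (hρ : 0 ≤ ρ)
    (hcosh : Real.cosh ρ =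
      Real.cosh r * Real.cosh r' - Real.sinh r * Real.sinh r' * Real.cos γ) :
    (Summable (fun n : ℕ => (-1 : ℂ) ^ n * (n + μ) *
          legendreP ν (-(μ + n)) (Real.cosh (min r r')) *
          legendreP ν (μ + n) (Real.cosh (max r r')) * gegenbauerC n μ (Real.cos γ)) ∧
      1 / (Real.sinh ρ : ℂ) ^ μ * legendreP ν μ (Real.cosh ρ) =
        (2 : ℂ) ^ μ * Complex.Gamma μ / ((Real.sinh r * Real.sinh r' : ℝ) : ℂ) ^ μ *
          ∑' n : ℕ, (-1 : ℂ) ^ n * (n + μ) *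
            legendreP ν (-(μ + n)) (Real.cosh (min r r')) *
            legendreP ν (μ + n) (Real.cosh (max r r')) * gegenbauerC n μ (Real.cos γ)) ∧
    ((∀ k : ℕ, 1 ≤ k → ν + μ ≠ -(k : ℂ)) →
      Summable (fun n : ℕ => (-1 : ℂ) ^ n * (n + μ) *
          legendreP ν (-(μ + n)) (Real.cosh (min r r')) *
          legendreQ ν (μ + n) (Real.cosh (max r r')) * gegenbauerC n μ (Real.cos γ)) ∧
      1 / (Real.sinh ρ : ℂ) ^ μ * legendreQ ν μ (Real.cosh ρ) =
        (2 : ℂ) ^ μ * Complex.Gamma μ / ((Real.sinh r * Real.sinh r' : ℝ) : ℂ) ^ μ *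
          ∑' n : ℕ, (-1 : ℂ) ^ n * (n + μ) *
            legendreP ν (-(μ + n)) (Real.cosh (min r r')) *
            legendreQ ν (μ + n) (Real.cosh (max r r')) * gegenbauerC n μ (Real.cos γ)) := by
  -- Both sides are symmetric in r and r'.
  wlog h : r < r' generalizing r r'
  · have := this r' r hr' hr hrr'.symm (by rw [hcosh]; ring)
      (lt_of_le_of_ne (not_lt.mp h) hrr'.symm)
    rwa [min_comm, max_comm, mul_comm (Real.sinh r')] at this
  rw [min_eq_left h.le, max_eq_right h.le]
  constructor
  · have := hyperbolic_addition_theorem (ν := ν) hμ hμ0 (F := fun n => reducedP ν (μ + n))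
      (L := fun n => legendreP ν (μ + n))
      (fun n z hz => by
        have := hasDerivAt_reducedP ν (μ + n) hz
        rw [add_assoc] at this
        exact_mod_cast this)
      (fun n z hz => by
        have := reducedP_recurrence ν (μ + n) hz
        rw [legendreConst]
        push_cast
        simpa only [add_assoc] using this)
      (fun n r hr => legendreP_cosh ν (μ + n) hr) hr h hρ hcosh
    simpa only [Nat.cast_zero, add_zero] using this
  · intro hνμ
    -- The hypothesis on ν + μ keeps Γ(ν + μ + n + 1) away from its poles for every n, as the shift
    -- relations for Q require.
    have hne : ∀ n : ℕ, ν + (μ + n) + 1 ≠ 0 := fun n h0 =>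
      hνμ (n + 1) (by omega) (by push_cast; linear_combination h0)
    have := hyperbolic_addition_theorem (ν := ν) hμ hμ0 (F := fun n => reducedQ ν (μ + n))
      (L := fun n => legendreQ ν (μ + n))
      (fun n z hz => by
        have := hasDerivAt_reducedQ (hne n) hz
        rw [add_assoc μ] at this
        exact_mod_cast this)
      (fun n z hz => by
        have := reducedQ_recurrence (hne n) (by
          have := hne (n + 1)
          push_cast at this
          intro h0
          exact this (by linear_combination h0)) hz
        rw [legendreConst]
        push_cast
        simpa only [add_assoc] using this)
      (fun n r hr => legendreQ_cosh ν (μ + n) hr) hr h hρ hcosh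
    simpa only [Nat.cast_zero, add_zero] using this
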